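/- Let $r,t\in(0,1)$ with $r^2+t^2=1$, let $\mathbb T=\mathbb R/2\pi\mathbb Z$, and let $\mathbb P_0,\mathbb P_1$ be arbitrary Borel probability measures on $\mathbb T$. Let $\Omega=\mathbb T^{\mathbb Z}$ carry the product measure $\mathbb P$ under which the coordinates $\omega_k$ are independent, with law $\mathbb P_0$ for even $k$ and $\mathbb P_1$ for odd $k$. Put $\theta_k=\omega_{2k}$, $\alpha_k=\omega_{2k+1}$ and $\eta_k=\theta_k+\theta_{k-1}+\alpha_k-\alpha_{k-1}$. Let $U_\omega$ be the unitary operator on $\ell^2(\mathbb Z)$, with canonical basis $(\varphi_k)_{k\in\mathbb Z}$, such that for all $k\in\mathbb Z$ $$U_\omega\varphi_{2k}=irt\,e^{-i\eta_{2k}}\varphi_{2k-1}+r^2e^{-i\eta_{2k}}\varphi_{2k}+irt\,e^{-i\eta_{2k+1}}\varphi_{2k+1}-t^2e^{-i\eta_{2k+1}}\varphi_{2k+2},$$ $$U_\omega\varphi_{2k+1}=-t^2e^{-i\eta_{2k}}\varphi_{2k-1}+irt\,e^{-i\eta_{2k}}\varphi_{2k}+r^2e^{-i\eta_{2k+1}}\varphi_{2k+1}+irt\,e^{-i\eta_{2k+1}}\varphi_{2k+2}.$$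 There is a unique Borel measure $dk$ on $\mathbb T$ (the density of states) such that for every continuous $f:S^1\to\mathbb C$ the random variable $\langle\varphi_0,f(U_\omega)\varphi_0\rangle+\langle\varphi_1,f(U_\omega)\varphi_1\rangle$ is integrable and $$\int_{\mathbb T}f(e^{i\lambda})\,dk(\lambda)=\tfrac12\,\mathbb E\big[\langle\varphi_0,f(U_\omega)\varphi_0\rangle+\langle\varphi_1,f(U_\omega)\varphi_1\rangle\big];$$ it is a probability measure. For integers $M<N$ let $\chi_{M,N}$ be the orthogonal projection of $\ell^2(\mathbb Z)$ onto the span of $\varphi_{M+1},\dots,\varphi_N$. Then: (1) For $\mathbb P$-almost every $\omega$, for every continuous $f:S^1\to\mathbb C$ and every constant $C$, $$\frac{\operatorname{tr}\big(\chi_{M,N}f(U_\omega)\chi_{M,N}\big)}{N-M}\longrightarrow\int_{\mathbb T}f(e^{i\lambda})\,dk(\lambda)$$ as $N-M\to\infty$ along pairs $(M,N)$ with $|M|\le C\,(N-M)$. (This covers, for example, $M$ fixed and $N\to\infty$, $N$ fixed and $M\to-\infty$, and all windows with $M\le0\le N$.) (2) There is a set $\Sigma\subset S^1$ with $\sigma(U_\omega)=\Sigma$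 for $\mathbb P$-almost every $\omega$ (the almost sure spectrum), and $\{e^{i\lambda}:\lambda\in\operatorname{supp}dk\}=\Sigma$. -/

import Mathlib

open Filter Topology MeasureTheory
open scoped InnerProductSpace

/-- The torus `𝕋 = ℝ / 2πℤ`. -/
abbrev PhaseTorus : Type := AddCircle (2 * Real.pi)

/-- The Hilbert space `ℓ²(ℤ)`. -/
abbrev LatticeSpace : Type := lp (fun _ : ℤ => ℂ) 2

namespace RandomUnitary

noncomputable section

/-- The complex number `e^{iθ}` for `θ` in the torus. -/
def expI (θ : PhaseTorus) : ℂ := (AddCircle.toCircle θ : ℂ)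

/-- The canonical basis vector `φ_k` of `ℓ²(ℤ)`. -/
def basisVec (k : ℤ) : LatticeSpace := lp.single 2 k (1 : ℂ)

/-! ### The random phases -/

/-- `θ_k(ω) = ω_{2k}`. -/
def thetaPhase (ω : ℤ → PhaseTorus) (k : ℤ) : PhaseTorus := ω (2 * k)

/-- `α_k(ω) = ω_{2k+1}`. -/
def alphaPhase (ω : ℤ → PhaseTorus) (k : ℤ) : PhaseTorus := ω (2 * k + 1)

/-- `η_k = θ_k + θ_{k-1} + α_k - α_{k-1}`. -/
def etaPhase (ω : ℤ → PhaseTorus) (k : ℤ) : PhaseTorus :=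
  thetaPhase ω k + thetaPhase ω (k - 1) + alphaPhase ω k - alphaPhase ω (k - 1)

/-- The law of the coordinate `ω_k`: it is `P₀` for even `k` and `P₁` for odd `k`. -/
def coordLaw (P₀ P₁ : Measure PhaseTorus) (k : ℤ) : Measure PhaseTorus :=
  if Even k then P₀ else P₁

instance (P₀ P₁ : Measure PhaseTorus) [IsProbabilityMeasure P₀] [IsProbabilityMeasure P₁]
    (k : ℤ) : IsProbabilityMeasure (coordLaw P₀ P₁ k) := by
  unfold coordLaw
  split_ifs <;> infer_instance

/-- The product probability measure on `𝕋^ℤ`. -/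
def phaseLaw (P₀ P₁ : Measure PhaseTorus) [IsProbabilityMeasure P₀] [IsProbabilityMeasure P₁] :
    Measure (ℤ → PhaseTorus) :=
  Measure.infinitePi (coordLaw P₀ P₁)

/-! ### The five-diagonal unitary operator -/

/-- The vector `U φ_k` for the phases `η`, with `k = 2m` in the first case and `k = 2m + 1` in
the second. -/
def column (r t : ℝ) (η : ℤ → PhaseTorus) (k : ℤ) : LatticeSpace :=
  if Even k then
    (Complex.I * r * t * expI (-η k)) • basisVec (k - 1)
      + ((r : ℂ) ^ 2 * expI (-η k)) • basisVec k
      + (Complex.I * r * t * expI (-η (k + 1))) • basisVec (k + 1)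
      + (-(t : ℂ) ^ 2 * expI (-η (k + 1))) • basisVec (k + 2)
  else
    (-(t : ℂ) ^ 2 * expI (-η (k - 1))) • basisVec (k - 2)
      + (Complex.I * t * r * expI (-η (k - 1))) • basisVec (k - 1)
      + ((r : ℂ) ^ 2 * expI (-η k)) • basisVec k
      + (Complex.I * r * t * expI (-η k)) • basisVec (k + 1)

theorem inner_basisVec_eq {i j : ℤ} (h : i = j) : ⟪basisVec i, basisVec j⟫_ℂ = 1 := by
  subst h
  simp [basisVec]

theorem inner_basisVec_ne {i j : ℤ} (h : i ≠ j) : ⟪basisVec i, basisVec j⟫_ℂ = 0 := by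
  simp [basisVec, lp.inner_single_left, lp.single_apply, h]

/-- A vector supported on the sites `2a - 1, 2a, 2a + 1, 2a + 2`. -/
def blockVec (a : ℤ) (x₀ x₁ x₂ x₃ : ℂ) : LatticeSpace :=
  x₀ • basisVec (2 * a - 1) + x₁ • basisVec (2 * a) + x₂ • basisVec (2 * a + 1)
    + x₃ • basisVec (2 * a + 2)

theorem column_even (r t : ℝ) (η : ℤ → PhaseTorus) (a : ℤ) :
    column r t η (2 * a) = blockVec a (Complex.I * r * t * expI (-η (2 * a)))
      ((r : ℂ) ^ 2 * expI (-η (2 * a))) (Complex.I * r * t * expI (-η (2 * a + 1)))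
      (-(t : ℂ) ^ 2 * expI (-η (2 * a + 1))) := by
  simp [column, blockVec]

theorem column_odd (r t : ℝ) (η : ℤ → PhaseTorus) (a : ℤ) :
    column r t η (2 * a + 1) = blockVec a (-(t : ℂ) ^ 2 * expI (-η (2 * a)))
      (Complex.I * t * r * expI (-η (2 * a))) ((r : ℂ) ^ 2 * expI (-η (2 * a + 1)))
      (Complex.I * r * t * expI (-η (2 * a + 1))) := by
  have h1 : 2 * a + 1 - 2 = 2 * a - 1 := by ring
  have h2 : 2 * a + 1 + 1 = 2 * a + 2 := by ring
  simp [column, blockVec, h1, h2]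

theorem inner_blockVec_self (a : ℤ) (x₀ x₁ x₂ x₃ y₀ y₁ y₂ y₃ : ℂ) :
    ⟪blockVec a x₀ x₁ x₂ x₃, blockVec a y₀ y₁ y₂ y₃⟫_ℂ
      = star x₀ * y₀ + star x₁ * y₁ + star x₂ * y₂ + star x₃ * y₃ := by
  simp (disch := omega) only [blockVec, inner_add_left, inner_add_right, inner_smul_left,
    inner_smul_right, inner_basisVec_eq, inner_basisVec_ne]
  simp only [starRingEnd_apply]
  ring

theorem inner_blockVec_succ (a : ℤ) (x₀ x₁ x₂ x₃ y₀ y₁ y₂ y₃ : ℂ) :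
    ⟪blockVec a x₀ x₁ x₂ x₃, blockVec (a + 1) y₀ y₁ y₂ y₃⟫_ℂ
      = star x₂ * y₀ + star x₃ * y₁ := by
  simp (disch := omega) only [blockVec, inner_add_left, inner_add_right, inner_smul_left,
    inner_smul_right, inner_basisVec_eq, inner_basisVec_ne]
  simp only [starRingEnd_apply]
  ring

theorem inner_blockVec_far {a b : ℤ} (h : a + 2 ≤ b) (x₀ x₁ x₂ x₃ y₀ y₁ y₂ y₃ : ℂ) :
    ⟪blockVec a x₀ x₁ x₂ x₃, blockVec b y₀ y₁ y₂ y₃⟫_ℂ = 0 := by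
  simp (disch := omega) only [blockVec, inner_add_left, inner_add_right, inner_smul_left,
    inner_smul_right, inner_basisVec_ne]
  ring

theorem star_expI_mul (θ : PhaseTorus) : star (expI θ) * expI θ = 1 := by
  have : star (expI θ) * expI θ = ((Complex.normSq (expI θ) : ℝ) : ℂ) := by
    rw [Complex.normSq_eq_conj_mul_self]; rfl
  rw [this, expI]; simp

theorem expI_mul_star (θ : PhaseTorus) : expI θ * star (expI θ) = 1 := by
  rw [mul_comm, star_expI_mul]

theorem inner_column_of_lt {r t : ℝ} (η : ℤ → PhaseTorus) {i j : ℤ} (hij : i < j) :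
    ⟪column r t η i, column r t η j⟫_ℂ = 0 := by
  have hI : Complex.I ^ 2 = -1 := Complex.I_sq
  have hr : star (r : ℂ) = r := Complex.conj_ofReal r
  have ht : star (t : ℂ) = t := Complex.conj_ofReal t
  have hSI : star Complex.I = -Complex.I := Complex.conj_I
  have aux : ∀ a b : ℤ, a = b ∨ b = a + 1 ∨ a + 2 ≤ b ∨ b < a := by intro a b; omega
  rcases Int.even_or_odd' i with ⟨a, rfl | rfl⟩ <;>
    rcases Int.even_or_odd' j with ⟨b, rfl | rfl⟩ <;>
    rcases aux a b with rfl | rfl | h | h <;>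
    first
    | (exfalso; omega)
    | (simp only [column_even, column_odd, inner_blockVec_far h])
    | (simp only [column_even, column_odd, inner_blockVec_self, inner_blockVec_succ, star_mul',
        star_neg, star_pow, hr, ht, hSI]
       have e1 := star_expI_mul (-η (2 * a))
       have e2 := star_expI_mul (-η (2 * a + 1))
       first
       | ring1
       | linear_combination Complex.I * r * t * ((r : ℂ) ^ 2 + (t : ℂ) ^ 2) * (e1 - e2)
       | linear_combination (-(r : ℂ) ^ 2 * (t : ℂ) ^ 2 * star (expI (-η (2 * a + 1)))
            * expI (-η (2 * (a + 1)))) * hI)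

theorem orthonormal_column {r t : ℝ} (hrt : r ^ 2 + t ^ 2 = 1) (η : ℤ → PhaseTorus) :
    Orthonormal ℂ (column r t η) := by
  have hc : (r : ℂ) ^ 2 + (t : ℂ) ^ 2 = 1 := by exact_mod_cast hrt
  have hI : Complex.I ^ 2 = -1 := Complex.I_sq
  have hr : star (r : ℂ) = r := Complex.conj_ofReal r
  have ht : star (t : ℂ) = t := Complex.conj_ofReal t
  have hSI : star Complex.I = -Complex.I := Complex.conj_I
  rw [orthonormal_iff_ite]
  intro i j
  rcases lt_trichotomy i j with h | rfl | h
  · rw [inner_column_of_lt η h, if_neg h.ne]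
  · rw [if_pos rfl]
    rcases Int.even_or_odd' i with ⟨a, rfl | rfl⟩ <;>
    · simp only [column_even, column_odd, inner_blockVec_self, star_mul',
        star_neg, star_pow, hr, ht, hSI]
      have e1 := star_expI_mul (-η (2 * a))
      have e2 := star_expI_mul (-η (2 * a + 1))
      first
      | linear_combination
          (-(r : ℂ) ^ 2 * (t : ℂ) ^ 2 * (star (expI (-η (2 * a))) * expI (-η (2 * a))
            + star (expI (-η (2 * a + 1))) * expI (-η (2 * a + 1)))) * hI
          + ((r : ℂ) ^ 2 * (t : ℂ) ^ 2 + (r : ℂ) ^ 4) * e1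
          + ((r : ℂ) ^ 2 * (t : ℂ) ^ 2 + (t : ℂ) ^ 4) * e2
          + ((r : ℂ) ^ 2 + (t : ℂ) ^ 2 + 1) * hc
      | linear_combination
          (-(r : ℂ) ^ 2 * (t : ℂ) ^ 2 * (star (expI (-η (2 * a))) * expI (-η (2 * a))
            + star (expI (-η (2 * a + 1))) * expI (-η (2 * a + 1)))) * hI
          + ((r : ℂ) ^ 2 * (t : ℂ) ^ 2 + (t : ℂ) ^ 4) * e1
          + ((r : ℂ) ^ 2 * (t : ℂ) ^ 2 + (r : ℂ) ^ 4) * e2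
          + ((r : ℂ) ^ 2 + (t : ℂ) ^ 2 + 1) * hc
  · rw [if_neg h.ne', ← inner_conj_symm, inner_column_of_lt η h, map_zero]

theorem combine_blockVec (a : ℤ) (s₀ s₁ s₂ s₃ x₀ x₁ x₂ x₃ y₀ y₁ y₂ y₃ z₀ z₁ z₂ z₃ w₀ w₁ w₂ w₃
      c₀ c₁ c₂ c₃ c₄ c₅ : ℂ)
    (h₀ : s₀ * x₀ + s₁ * y₀ = c₀) (h₁ : s₀ * x₁ + s₁ * y₁ = c₁)
    (h₂ : s₀ * x₂ + s₁ * y₂ + s₂ * z₀ + s₃ * w₀ = c₂)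
    (h₃ : s₀ * x₃ + s₁ * y₃ + s₂ * z₁ + s₃ * w₁ = c₃)
    (h₄ : s₂ * z₂ + s₃ * w₂ = c₄) (h₅ : s₂ * z₃ + s₃ * w₃ = c₅) :
    s₀ • blockVec a x₀ x₁ x₂ x₃ + s₁ • blockVec a y₀ y₁ y₂ y₃
      + s₂ • blockVec (a + 1) z₀ z₁ z₂ z₃ + s₃ • blockVec (a + 1) w₀ w₁ w₂ w₃
    = c₀ • basisVec (2 * a - 1) + c₁ • basisVec (2 * a) + c₂ • basisVec (2 * a + 1)
      + c₃ • basisVec (2 * a + 2) + c₄ • basisVec (2 * a + 3) + c₅ • basisVec (2 * a + 4) := by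
  have e0 : 2 * (a + 1) - 1 = 2 * a + 1 := by ring
  have e1 : 2 * (a + 1) = 2 * a + 2 := by ring
  have e2 : 2 * a + 2 + 1 = 2 * a + 3 := by ring
  have e3 : 2 * a + 2 + 2 = 2 * a + 4 := by ring
  subst h₀ h₁ h₂ h₃ h₄ h₅
  simp only [blockVec, e0]
  simp only [e1, e2, e3]
  module

theorem basisVec_mem_span {r t : ℝ} (hrt : r ^ 2 + t ^ 2 = 1) (η : ℤ → PhaseTorus) (k : ℤ) :
    basisVec k ∈ Submodule.span ℂ (Set.range (column r t η)) := by
  have hc : (r : ℂ) ^ 2 + (t : ℂ) ^ 2 = 1 := by exact_mod_cast hrt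
  have hI : Complex.I ^ 2 = -1 := Complex.I_sq
  have hr : star (r : ℂ) = r := Complex.conj_ofReal r
  have ht : star (t : ℂ) = t := Complex.conj_ofReal t
  have hSI : star Complex.I = -Complex.I := Complex.conj_I
  obtain ⟨a, ha⟩ : ∃ a, k = 2 * a + 1 ∨ k = 2 * a + 2 := ⟨(k - 1) / 2, by omega⟩
  have e2 := star_expI_mul (-η (2 * a + 1))
  have f1 := star_expI_mul (-η (2 * (a + 1)))
  set A := expI (-η (2 * a + 1)) with hA
  set B := expI (-η (2 * (a + 1))) with hB
  have mem : ∀ s₀ s₁ s₂ s₃ : ℂ, s₀ • column r t η (2 * a) + s₁ • column r t η (2 * a + 1)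
      + s₂ • column r t η (2 * (a + 1)) + s₃ • column r t η (2 * (a + 1) + 1)
      ∈ Submodule.span ℂ (Set.range (column r t η)) := fun s₀ s₁ s₂ s₃ => by
    have hm : ∀ j, column r t η j ∈ Submodule.span ℂ (Set.range (column r t η)) :=
      fun j => Submodule.subset_span ⟨j, rfl⟩
    exact add_mem (add_mem (add_mem (Submodule.smul_mem _ _ (hm _)) (Submodule.smul_mem _ _ (hm _)))
      (Submodule.smul_mem _ _ (hm _))) (Submodule.smul_mem _ _ (hm _))
  rcases ha with rfl | rfl
  · convert mem (-Complex.I * r * t * star A) ((r : ℂ) ^ 2 * star A)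
      (-Complex.I * r * t * star B) (-(t : ℂ) ^ 2 * star B) using 1
    simp only [column_even, column_odd, ← hA, ← hB]
    refine (combine_blockVec a _ _ _ _ _ _ _ _ _ _ _ _ _ _ _ _ _ _ _ _ 0 0 1 0 0 0
      ?_ ?_ ?_ ?_ ?_ ?_ |>.trans (by simp)).symm
    · linear_combination (-(r : ℂ) ^ 2 * (t : ℂ) ^ 2 * star A * expI (-η (2 * a))) * hI
    · ring
    · linear_combination
        (-(r : ℂ) ^ 2 * (t : ℂ) ^ 2 * (star A * A + star B * B)) * hI
        + ((r : ℂ) ^ 2 * (t : ℂ) ^ 2 + (r : ℂ) ^ 4) * e2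
        + ((r : ℂ) ^ 2 * (t : ℂ) ^ 2 + (t : ℂ) ^ 4) * f1
        + ((r : ℂ) ^ 2 + (t : ℂ) ^ 2 + 1) * hc
    · linear_combination Complex.I * r * t * ((r : ℂ) ^ 2 + (t : ℂ) ^ 2) * (e2 - f1)
    · linear_combination
        (-(r : ℂ) ^ 2 * (t : ℂ) ^ 2 * star B * expI (-η (2 * (a + 1) + 1))) * hI
    · ring
  · convert mem (-(t : ℂ) ^ 2 * star A) (-Complex.I * r * t * star A)
      ((r : ℂ) ^ 2 * star B) (-Complex.I * r * t * star B) using 1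
    simp only [column_even, column_odd, ← hA, ← hB]
    refine (combine_blockVec a _ _ _ _ _ _ _ _ _ _ _ _ _ _ _ _ _ _ _ _ 0 0 0 1 0 0
      ?_ ?_ ?_ ?_ ?_ ?_ |>.trans (by simp)).symm
    · ring
    · linear_combination (-(r : ℂ) ^ 2 * (t : ℂ) ^ 2 * star A * expI (-η (2 * a))) * hI
    · linear_combination -Complex.I * r * t * ((r : ℂ) ^ 2 + (t : ℂ) ^ 2) * (e2 - f1)
    · linear_combination
        (-(r : ℂ) ^ 2 * (t : ℂ) ^ 2 * (star A * A + star B * B)) * hI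
        + ((r : ℂ) ^ 2 * (t : ℂ) ^ 2 + (t : ℂ) ^ 4) * e2
        + ((r : ℂ) ^ 2 * (t : ℂ) ^ 2 + (r : ℂ) ^ 4) * f1
        + ((r : ℂ) ^ 2 + (t : ℂ) ^ 2 + 1) * hc
    · ring
    · linear_combination
        (-(r : ℂ) ^ 2 * (t : ℂ) ^ 2 * star B * expI (-η (2 * (a + 1) + 1))) * hI

/-- The columns form an orthonormal basis of `ℓ²(ℤ)`. -/
def columnBasis {r t : ℝ} (hrt : r ^ 2 + t ^ 2 = 1) (η : ℤ → PhaseTorus) :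
    HilbertBasis ℤ ℂ LatticeSpace :=
  HilbertBasis.mk (orthonormal_column hrt η) (by
    have h := (⟨LinearIsometryEquiv.refl ℂ LatticeSpace⟩ :
      HilbertBasis ℤ ℂ LatticeSpace).dense_span
    rw [← h]
    refine Submodule.topologicalClosure_mono (Submodule.span_le.2 ?_)
    rintro _ ⟨k, rfl⟩
    rw [← HilbertBasis.repr_symm_single]
    exact basisVec_mem_span hrt η k)

/-- The unitary operator of `ℓ²(ℤ)` with `U φ_k = column r t η k` for all `k`. -/
def bandUnitary {r t : ℝ} (hrt : r ^ 2 + t ^ 2 = 1) (η : ℤ → PhaseTorus) :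
    LatticeSpace ≃ₗᵢ[ℂ] LatticeSpace :=
  (columnBasis hrt η).repr.symm

theorem bandUnitary_basisVec {r t : ℝ} (hrt : r ^ 2 + t ^ 2 = 1) (η : ℤ → PhaseTorus) (k : ℤ) :
    bandUnitary hrt η (basisVec k) = column r t η k := by
  rw [bandUnitary, basisVec, HilbertBasis.repr_symm_single, columnBasis, HilbertBasis.coe_mk]

/-- The random operator `U_ω`, as a bounded operator on `ℓ²(ℤ)`. -/
def randomU {r t : ℝ} (hrt : r ^ 2 + t ^ 2 = 1) (ω : ℤ → PhaseTorus) :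
    LatticeSpace →L[ℂ] LatticeSpace :=
  (bandUnitary hrt (etaPhase ω)).toContinuousLinearEquiv

theorem randomU_basisVec {r t : ℝ} (hrt : r ^ 2 + t ^ 2 = 1) (ω : ℤ → PhaseTorus) (k : ℤ) :
    randomU hrt ω (basisVec k) = column r t (etaPhase ω) k :=
  bandUnitary_basisVec hrt (etaPhase ω) k

theorem randomU_mem_unitary {r t : ℝ} (hrt : r ^ 2 + t ^ 2 = 1) (ω : ℤ → PhaseTorus) :
    randomU hrt ω ∈ unitary (LatticeSpace →L[ℂ] LatticeSpace) :=
  (Unitary.linearIsometryEquiv.symm (bandUnitary hrt (etaPhase ω))).2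

/-! ### The density of states -/

/-- `k` is a density of states: for every continuous `f` on the unit circle,
`∫ f(e^{iλ}) dk(λ) = 𝔼[⟨φ₀, f(U_ω) φ₀⟩ + ⟨φ₁, f(U_ω) φ₁⟩] / 2`, where the random variable on the
right is integrable. Here `f(U_ω)` is given by the continuous functional calculus, which only
involves the values of `f` on the unit circle, as `U_ω` is unitary. -/
def IsDensityOfStates {r t : ℝ} (hrt : r ^ 2 + t ^ 2 = 1) (P₀ P₁ : Measure PhaseTorus)
    [IsProbabilityMeasure P₀] [IsProbabilityMeasure P₁] (k : Measure PhaseTorus) : Prop :=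
  ∀ f : ℂ → ℂ, ContinuousOn f (Metric.sphere 0 1) →
    Integrable (fun ω => ⟪basisVec 0, cfc f (randomU hrt ω) (basisVec 0)⟫_ℂ
      + ⟪basisVec 1, cfc f (randomU hrt ω) (basisVec 1)⟫_ℂ) (phaseLaw P₀ P₁) ∧
    ∫ x, f (expI x) ∂k
      = (∫ ω, (⟪basisVec 0, cfc f (randomU hrt ω) (basisVec 0)⟫_ℂ
          + ⟪basisVec 1, cfc f (randomU hrt ω) (basisVec 1)⟫_ℂ) ∂(phaseLaw P₀ P₁)) / 2

/-- The orthogonal projection `χ_{M,N}` of `ℓ²(ℤ)` onto the sites in `[M + 1, N]`. -/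
def siteProj (M N : ℤ) : LatticeSpace →L[ℂ] LatticeSpace :=
  ∑ j ∈ Finset.Ioc M N, InnerProductSpace.rankOne ℂ (basisVec j) (basisVec j)

theorem siteProj_apply (M N : ℤ) (ψ : LatticeSpace) (k : ℤ) :
    siteProj M N ψ k = if k ∈ Finset.Ioc M N then ψ k else 0 := by
  have h : ∀ s : Finset ℤ, (∑ j ∈ s, InnerProductSpace.rankOne ℂ (basisVec j) (basisVec j)) ψ k
      = if k ∈ s then ψ k else 0 := by
    intro s
    induction s using Finset.induction_on with
    | empty => simp
    | insert a s ha ih =>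
      rw [Finset.sum_insert ha, add_apply, lp.coeFn_add, Pi.add_apply, ih]
      by_cases hk : k = a
      · subst hk
        simp [ha, basisVec, lp.inner_single_left]
      · simp [hk, basisVec]
  exact h _

/-- The trace `∑_j ⟨φ_j, A φ_j⟩` of an operator on `ℓ²(ℤ)` (used here for operators of finite
rank whose range is spanned by finitely many of the `φ_j`, so that the sum is finite). -/
def latticeTrace (A : LatticeSpace →L[ℂ] LatticeSpace) : ℂ :=
  ∑' j : ℤ, ⟪basisVec j, A (basisVec j)⟫_ℂ

/-- The limit `N - M → ∞` for pairs `(M, N)` of integers with `|M| ≤ C (N - M)`. -/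
def boxFilter (C : ℝ) : Filter (ℤ × ℤ) :=
  comap (fun p : ℤ × ℤ => p.2 - p.1) atTop ⊓
    𝓟 {p : ℤ × ℤ | |(p.1 : ℝ)| ≤ C * ((p.2 : ℝ) - (p.1 : ℝ))}

/-- `S` is the almost sure spectrum of `U_ω`. -/
def IsAlmostSureSpectrum {r t : ℝ} (hrt : r ^ 2 + t ^ 2 = 1) (P₀ P₁ : Measure PhaseTorus)
    [IsProbabilityMeasure P₀] [IsProbabilityMeasure P₁] (S : Set ℂ) : Prop :=
  ∀ᵐ ω ∂(phaseLaw P₀ P₁), spectrum ℂ (randomU hrt ω) = S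

end

end RandomUnitary

/-! Everything is read off from the diagonal entries `⟨φ_j, f(U_ω) φ_j⟩`. For `f = z ^ p` with `p`
an integer, such an entry is a continuous function of the phases with index within `4|p|` of `2j`
(`dependsOn_diagEntry_zpow`), because `U_ω` is a band operator and `U_ω⁻¹` is its adjoint. Moving
the site by `2m` amounts to a measure-preserving shift of the phases (`diagEntry_zpow_add`,
`measurePreserving_shiftPhases`). Along an arithmetic progression of sites with a large even step
the entries are therefore independent and identically distributed. The strong law applies there, and
the finitely many residue classes recombine (`AverageTo.of_residues`).

The averages over the two half-lines control every window with `|M| ≤ C (N - M)`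
(`tendsto_boxFilter_average`). There are only countably many exponents, so one null set serves all
of them. Since the functional calculus is contractive, uniform approximation by Laurent polynomials
extends the convergence to all continuous `f` off this same null set (`ae_tendsto_boxAverage`).

The limit `stateMean` is a positive functional, because `star f * f` has as mean an average of
`‖f(U_ω) φ_j‖²`. The Riesz–Markov–Kakutani theorem then gives the measure.

For the spectrum, both inclusions test the distance `d` to a closed set. If `d` is the distance to
the image of the support, then `d²` has mean zero, so `d(U_ω) = 0` almost surely and `d` vanishes on
the spectrum. If `d` is the distance to the spectrum of one typical `ω`, then `d(U_ω) = 0`, all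
window averages of `d²` vanish, hence so does its mean, and `d` vanishes on the support. No
ergodicity is used: that the spectrum is almost surely constant comes out of these two inclusions.
-/

namespace RandomUnitary

noncomputable section

/-! ### Cesàro averages and windows of the lattice -/

/-- The averages of the sequence `y` converge to `E`, in a quantitative form which also controls
short averages. -/
def AverageTo (y : ℕ → ℂ) (E : ℂ) : Prop :=
  ∀ ε : ℝ, 0 < ε → ∃ K : ℝ, ∀ n : ℕ, ‖∑ i ∈ Finset.range n, (y i - E)‖ ≤ ε * n + K

theorem averageTo_of_tendsto {y : ℕ → ℂ} {E : ℂ}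
    (h : Tendsto (fun n : ℕ => (n : ℝ)⁻¹ • ∑ i ∈ Finset.range n, y i) atTop (𝓝 E)) :
    AverageTo y E := by
  intro ε hε
  obtain ⟨n₀, hn₀⟩ := (Metric.tendsto_atTop.1 h) ε hε
  -- The constant dominates each of the finitely many short sums, to which the limit says nothing.
  refine ⟨∑ n ∈ Finset.range (n₀ + 1), ‖∑ i ∈ Finset.range n, (y i - E)‖, fun n => ?_⟩
  have hpos : 0 ≤ ∑ n ∈ Finset.range (n₀ + 1), ‖∑ i ∈ Finset.range n, (y i - E)‖ :=
    Finset.sum_nonneg fun _ _ => norm_nonneg _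
  rcases lt_or_ge n (n₀ + 1) with hn | hn
  · have := Finset.single_le_sum (f := fun n => ‖∑ i ∈ Finset.range n, (y i - E)‖)
      (fun _ _ => norm_nonneg _) (Finset.mem_range.2 hn)
    have h2 : 0 ≤ ε * n := by positivity
    linarith
  · have hn' : (0 : ℝ) < n := by exact_mod_cast (by omega : 0 < n)
    have h1 := (hn₀ n (by omega)).le
    rw [dist_eq_norm] at h1
    have h2 : ∑ i ∈ Finset.range n, (y i - E)
        = (n : ℝ) • ((n : ℝ)⁻¹ • (∑ i ∈ Finset.range n, y i) - E) := by
      rw [smul_sub, smul_inv_smul₀ hn'.ne', Finset.sum_sub_distrib]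
      simp
    rw [h2, norm_smul, Real.norm_of_nonneg hn'.le]
    nlinarith

theorem sum_range_mul_add (z : ℕ → ℂ) (L q : ℕ) :
    ∑ i ∈ Finset.range (L * q), z i
      = ∑ s ∈ Finset.range L, ∑ i ∈ Finset.range q, z (L * i + s) := by
  induction q with
  | zero => simp
  | succ q ih =>
    rw [Nat.mul_succ, Finset.sum_range_add, ih, ← Finset.sum_add_distrib]
    exact Finset.sum_congr rfl fun s _ => (Finset.sum_range_succ _ _).symm

/-- Write `n = L * q + r` with `r < L`. The first `L * q` terms split into `L` residue classes, each
controlled up to `ε * q` plus a constant. The fewer than `L` leftover terms are bounded by `B + ‖E‖`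
each. -/
theorem AverageTo.of_residues {y : ℕ → ℂ} {B : ℝ} (hB : ∀ n, ‖y n‖ ≤ B) {L : ℕ} (hL : 0 < L)
    {e : ℕ → ℂ} {E : ℂ} (he : ∀ s < L, AverageTo (fun q => y (L * q + s)) (e s))
    (hE : ∑ s ∈ Finset.range L, e s = L * E) : AverageTo y E := by
  intro ε hε
  have hK : ∀ s, ∃ K : ℝ, s < L → ∀ n : ℕ,
      ‖∑ i ∈ Finset.range n, (y (L * i + s) - e s)‖ ≤ ε * n + K := by
    intro s
    by_cases hs : s < L
    · obtain ⟨K, hK⟩ := he s hs ε hε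
      exact ⟨K, fun _ => hK⟩
    · exact ⟨0, fun h => absurd h hs⟩
  choose K hK using hK
  have hB0 : 0 ≤ B + ‖E‖ := add_nonneg ((norm_nonneg _).trans (hB 0)) (norm_nonneg _)
  refine ⟨∑ s ∈ Finset.range L, K s + L * (B + ‖E‖), fun n => ?_⟩
  have hn : L * (n / L) + n % L = n := Nat.div_add_mod n L
  set q := n / L
  set r := n % L
  have hr : r < L := Nat.mod_lt n hL
  have h1 : ∑ i ∈ Finset.range n, (y i - E)
      = ∑ s ∈ Finset.range L, ∑ i ∈ Finset.range q, (y (L * i + s) - e s)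
        + ∑ s ∈ Finset.range r, (y (L * q + s) - E) := by
    rw [← hn, Finset.sum_range_add, sum_range_mul_add]
    congr 1
    simp only [Finset.sum_sub_distrib, Finset.sum_const, Finset.card_range, nsmul_eq_mul,
      ← Finset.mul_sum, hE]
    ring
  rw [h1]
  refine (norm_add_le _ _).trans ?_
  have h2 : ‖∑ s ∈ Finset.range L, ∑ i ∈ Finset.range q, (y (L * i + s) - e s)‖
      ≤ ∑ s ∈ Finset.range L, (ε * q + K s) :=
    norm_sum_le_of_le _ fun s hs => hK s (Finset.mem_range.1 hs) q
  have h3 : ‖∑ s ∈ Finset.range r, (y (L * q + s) - E)‖ ≤ ∑ s ∈ Finset.range r, (B + ‖E‖) :=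
    norm_sum_le_of_le _ fun s _ => (norm_sub_le _ _).trans (by linarith [hB (L * q + s)])
  simp only [Finset.sum_add_distrib, Finset.sum_const, Finset.card_range, nsmul_eq_mul] at h2 h3
  have h4 : (L : ℝ) * q ≤ n := by exact_mod_cast (by omega : L * q ≤ n)
  have h5 : (r : ℝ) * (B + ‖E‖) ≤ L * (B + ‖E‖) :=
    mul_le_mul_of_nonneg_right (by exact_mod_cast hr.le) hB0
  have h6 : (L : ℝ) * (ε * q) ≤ ε * n := by nlinarith
  linarith

/-- Telescoping for a discrete primitive of `z`, normalised to vanish at `-1`. Thanks to the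
truncation in `toNat`, only one of its two half-line sums is nonempty at any point. -/
theorem sum_Ioc_eq_sub (z : ℤ → ℂ) {M N : ℤ} (h : M ≤ N) :
    ∑ j ∈ Finset.Ioc M N, z j
      = (∑ i ∈ Finset.range (N + 1).toNat, z i
          - ∑ i ∈ Finset.range (-1 - N).toNat, z (-1 - i))
        - (∑ i ∈ Finset.range (M + 1).toNat, z i
          - ∑ i ∈ Finset.range (-1 - M).toNat, z (-1 - i)) := by
  induction N, h using Int.leInduction with
  | base => simp
  | succ N hN ih =>
    have h1 : Finset.Ioc M (N + 1) = insert (N + 1) (Finset.Ioc M N) := by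
      ext j
      simp only [Finset.mem_Ioc, Finset.mem_insert]
      omega
    rw [h1, Finset.sum_insert (by simp), ih]
    -- From `-1` on, the new site `N + 1` lengthens the right half-line sum; below `-1`, it is
    -- removed from the left one.
    rcases le_or_gt (-1) N with h2 | h2
    · have h3 : (N + 1 + 1).toNat = (N + 1).toNat + 1 := by omega
      have h4 : (-1 - N).toNat = 0 := by omega
      have h5 : (-1 - (N + 1)).toNat = 0 := by omega
      have h6 : (((N + 1).toNat : ℕ) : ℤ) = N + 1 := by omega
      rw [h3, h4, h5, Finset.sum_range_succ, h6]
      ring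
    · have h3 : (-1 - N).toNat = (-1 - (N + 1)).toNat + 1 := by omega
      have h4 : (N + 1).toNat = 0 := by omega
      have h5 : (N + 1 + 1).toNat = 0 := by omega
      have h6 : -1 - (((-1 - (N + 1)).toNat : ℕ) : ℤ) = N + 1 := by omega
      rw [h3, h4, h5, Finset.sum_range_succ, h6]
      ring

/-- The point is that `K` does not depend on the window, so both ends may move at once. -/
theorem norm_sum_Ioc_le {y : ℤ → ℂ} {E : ℂ} (hp : AverageTo (fun n => y n) E)
    (hm : AverageTo (fun n => y (-1 - n)) E) {ε : ℝ} (hε : 0 < ε) :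
    ∃ K : ℝ, ∀ M N : ℤ, M ≤ N →
      ‖∑ j ∈ Finset.Ioc M N, (y j - E)‖ ≤ ε * (|(M : ℝ)| + |(N : ℝ)|) + K := by
  obtain ⟨K₁, h₁⟩ := hp ε hε
  obtain ⟨K₂, h₂⟩ := hm ε hε
  have key : ∀ n : ℤ, ‖∑ i ∈ Finset.range (n + 1).toNat, (y i - E)
          - ∑ i ∈ Finset.range (-1 - n).toNat, (y (-1 - i) - E)‖
        ≤ ε * |(n : ℝ)| + (ε + K₁ + K₂) := by
    intro n
    refine (norm_sub_le _ _).trans ((add_le_add (h₁ _) (h₂ _)).trans ?_)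
    have h3 : (((n + 1).toNat : ℕ) : ℝ) + (((-1 - n).toNat : ℕ) : ℝ) ≤ |(n : ℝ)| + 1 := by
      have : (((n + 1).toNat : ℕ) : ℤ) + (((-1 - n).toNat : ℕ) : ℤ) ≤ |n| + 1 := by
        rcases abs_cases n with ⟨h, _⟩ | ⟨h, _⟩ <;> omega
      exact_mod_cast this
    nlinarith
  refine ⟨2 * (ε + K₁ + K₂), fun M N h => ?_⟩
  rw [sum_Ioc_eq_sub (fun j => y j - E) h]
  refine (norm_sub_le _ _).trans ((add_le_add (key N) (key M)).trans (le_of_eq ?_))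
  ring

theorem tendsto_boxFilter_average {y : ℤ → ℂ} {E : ℂ} (hp : AverageTo (fun n => y n) E)
    (hm : AverageTo (fun n => y (-1 - n)) E) (C : ℝ) :
    Tendsto (fun p : ℤ × ℤ => (∑ j ∈ Finset.Ioc p.1 p.2, y j) / ((p.2 : ℂ) - (p.1 : ℂ)))
      (boxFilter C) (𝓝 E) := by
  rw [Metric.tendsto_nhds]
  intro δ hδ
  -- The box condition gives `|M| + |N| ≤ (2|C| + 1)(N - M)`, so this `ε` costs `δ/2` per site. The
  -- constant `K` costs less than another `δ/2` per site once `N - M > 2|K|/δ`.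
  set ε := δ / (2 * (2 * |C| + 1)) with hεdef
  have hε : 0 < ε := by positivity
  obtain ⟨K, hK⟩ := norm_sum_Ioc_le hp hm hε
  have hev : ∀ᶠ p : ℤ × ℤ in boxFilter C, ⌈2 * |K| / δ⌉ + 1 ≤ p.2 - p.1 ∧
      |(p.1 : ℝ)| ≤ C * ((p.2 : ℝ) - (p.1 : ℝ)) := by
    refine Filter.Eventually.and ?_ ?_
    · exact (tendsto_comap.eventually (eventually_ge_atTop (⌈2 * |K| / δ⌉ + 1))).filter_mono
        inf_le_left
    · exact (eventually_principal.2 fun _ h => h).filter_mono inf_le_right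
  filter_upwards [hev] with p ⟨h1, h2⟩
  obtain ⟨M, N⟩ := p
  dsimp only at h1 h2 ⊢
  have hd : 2 * |K| / δ < (N : ℝ) - M := by
    have h3 : ((⌈2 * |K| / δ⌉ : ℤ) : ℝ) + 1 ≤ (N : ℝ) - M := by exact_mod_cast h1
    linarith [Int.le_ceil (2 * |K| / δ)]
  have hd0 : 0 < (N : ℝ) - M := lt_of_le_of_lt (by positivity) hd
  have hMN : M ≤ N := by
    have : (M : ℝ) < N := by linarith
    exact_mod_cast this.le
  have hc : ((N : ℂ) - M) = (((N : ℝ) - M : ℝ) : ℂ) := by push_cast; rfl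
  have hc0 : ((N : ℂ) - M) ≠ 0 := by rw [hc]; exact_mod_cast hd0.ne'
  have h4 : (∑ j ∈ Finset.Ioc M N, y j) / ((N : ℂ) - M) - E
      = (∑ j ∈ Finset.Ioc M N, (y j - E)) / ((N : ℂ) - M) := by
    rw [Finset.sum_sub_distrib, Finset.sum_const, Int.card_Ioc, nsmul_eq_mul]
    have : (((N - M).toNat : ℕ) : ℂ) = (N : ℂ) - M := by
      have h5 : (((N - M).toNat : ℕ) : ℤ) = N - M := by omega
      exact_mod_cast congrArg (Int.cast : ℤ → ℂ) h5
    rw [this]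
    field_simp
  rw [dist_eq_norm, h4, norm_div, hc, Complex.norm_real, Real.norm_of_nonneg hd0.le,
    div_lt_iff₀ hd0]
  refine (hK M N hMN).trans_lt ?_
  have h6 : |(M : ℝ)| ≤ |C| * ((N : ℝ) - M) :=
    h2.trans (mul_le_mul_of_nonneg_right (le_abs_self C) hd0.le)
  have h7 : |(N : ℝ)| ≤ |(M : ℝ)| + ((N : ℝ) - M) := by
    have := abs_add_le (M : ℝ) ((N : ℝ) - M)
    rw [abs_of_pos hd0] at this
    simpa using this
  have h8 : ε * (|(M : ℝ)| + |(N : ℝ)|) ≤ ε * ((2 * |C| + 1) * ((N : ℝ) - M)) :=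
    mul_le_mul_of_nonneg_left (by linarith) hε.le
  have h9 : ε * ((2 * |C| + 1) * ((N : ℝ) - M)) = δ / 2 * ((N : ℝ) - M) := by
    rw [hεdef]
    field_simp
  have h10 : |K| < δ / 2 * ((N : ℝ) - M) := by
    rw [div_lt_iff₀ hδ] at hd
    linarith
  linarith [le_abs_self K]

/-- The windows `(0, n)` witness this; it is needed for uniqueness of limits along the boxes. -/
theorem boxFilter_neBot {C : ℝ} (hC : 0 ≤ C) : (boxFilter C).NeBot := by
  have h : Tendsto (fun n : ℤ => ((0 : ℤ), n)) atTop (boxFilter C) := by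
    refine tendsto_inf.2 ⟨tendsto_comap_iff.2 ?_, tendsto_principal.2 ?_⟩
    · have h0 : (fun p : ℤ × ℤ => p.2 - p.1) ∘ (fun n : ℤ => ((0 : ℤ), n)) = id := by
        ext n
        simp
      rw [h0]
      exact tendsto_id
    · filter_upwards [eventually_ge_atTop 0] with n hn
      have : (0 : ℝ) ≤ n := by exact_mod_cast hn
      simpa using mul_nonneg hC this
  exact h.neBot

end

end RandomUnitary

namespace RandomUnitary

noncomputable section

variable {r t : ℝ} (hrt : r ^ 2 + t ^ 2 = 1)

/-! ### Powers of the operator -/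

theorem continuous_expI : Continuous expI :=
  continuous_subtype_val.comp AddCircle.continuous_toCircle

theorem continuous_expI_neg_etaPhase (k : ℤ) :
    Continuous fun ω : ℤ → PhaseTorus => expI (-etaPhase ω k) := by
  refine continuous_expI.comp ?_
  unfold etaPhase thetaPhase alphaPhase
  fun_prop

theorem randomU_pow_succ_basisVec (ω : ℤ → PhaseTorus) (n : ℕ) (k : ℤ) :
    (randomU hrt ω ^ (n + 1)) (basisVec k) = (randomU hrt ω ^ n) (column r t (etaPhase ω) k) := by
  rw [pow_succ, mul_apply_eq_comp, randomU_basisVec]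

/-- Peeling off the innermost factor expresses the vector through `U ^ n` applied to four basis
vectors, with coefficients continuous in `ω`. -/
theorem continuous_randomU_pow_basisVec (n : ℕ) (k : ℤ) :
    Continuous fun ω => (randomU hrt ω ^ n) (basisVec k) := by
  induction n generalizing k with
  | zero => simpa using continuous_const
  | succ n ih =>
    have h := continuous_expI_neg_etaPhase
    simp only [randomU_pow_succ_basisVec, column]
    split_ifs <;> simp only [map_add, map_smul] <;> fun_prop

theorem etaPhase_congr {ω ω' : ℤ → PhaseTorus} {k : ℤ}
    (h : ∀ i ∈ Set.Icc (2 * k - 2) (2 * k + 1), ω i = ω' i) : etaPhase ω k = etaPhase ω' k := by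
  simp only [etaPhase, thetaPhase, alphaPhase]
  rw [h (2 * k) (by constructor <;> omega), h (2 * (k - 1)) (by constructor <;> omega),
    h (2 * k + 1) (by constructor <;> omega), h (2 * (k - 1) + 1) (by constructor <;> omega)]

/-- One application of `U` moves a site by at most 2, that is by 4 in the indices of the phases. Its
coefficients involve only `η` at `k - 1, k, k + 1`, hence phases within 4 of `2k`. So the radius
grows by 4 with each power. -/
theorem dependsOn_randomU_pow_basisVec (n : ℕ) (k : ℤ) :
    DependsOn (fun ω => (randomU hrt ω ^ n) (basisVec k))
      (Set.Icc (2 * k - 4 * n) (2 * k + 4 * n)) := by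
  induction n generalizing k with
  | zero => intro ω ω' _; simp
  | succ n ih =>
    intro ω ω' h
    have hb : ∀ i ∈ Set.Icc (k - 2) (k + 2),
        (randomU hrt ω ^ n) (basisVec i) = (randomU hrt ω' ^ n) (basisVec i) := by
      intro i hi
      refine ih i fun j hj => h j ?_
      simp only [Set.mem_Icc] at hi hj ⊢
      push_cast
      omega
    have he : ∀ i ∈ Set.Icc (k - 1) (k + 1), etaPhase ω i = etaPhase ω' i := by
      intro i hi
      refine etaPhase_congr fun j hj => h j ?_
      simp only [Set.mem_Icc] at hi hj ⊢
      push_cast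
      omega
    have b0 := hb k (by constructor <;> omega)
    have b1 := hb (k + 1) (by constructor <;> omega)
    have b2 := hb (k + 2) (by constructor <;> omega)
    have b3 := hb (k - 1) (by constructor <;> omega)
    have b4 := hb (k - 2) (by constructor <;> omega)
    have e0 := he k (by constructor <;> omega)
    have e1 := he (k + 1) (by constructor <;> omega)
    have e2 := he (k - 1) (by constructor <;> omega)
    simp only [randomU_pow_succ_basisVec, column]
    split_ifs <;> simp only [map_add, map_smul, b0, b1, b2, b3, b4, e0, e1, e2]

/-- The translation of the phases which corresponds to a translation of the lattice by `2m`. -/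
def shiftPhases (m : ℤ) (ω : ℤ → PhaseTorus) : ℤ → PhaseTorus := fun i => ω (i + 4 * m)

/-- Each `η_k` takes two coordinates of `ω` per unit of `k`, so `2m` sites correspond to `4m`
coordinates. -/
theorem etaPhase_shiftPhases (m : ℤ) (ω : ℤ → PhaseTorus) (k : ℤ) :
    etaPhase (shiftPhases m ω) k = etaPhase ω (k + 2 * m) := by
  simp only [etaPhase, thetaPhase, alphaPhase, shiftPhases]
  rw [show 2 * k + 4 * m = 2 * (k + 2 * m) by ring,
    show 2 * (k - 1) + 4 * m = 2 * (k + 2 * m - 1) by ring,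
    show 2 * k + 1 + 4 * m = 2 * (k + 2 * m) + 1 by ring,
    show 2 * (k - 1) + 1 + 4 * m = 2 * (k + 2 * m - 1) + 1 by ring]

theorem orthonormal_basisVec_add (a : ℤ) : Orthonormal ℂ fun k : ℤ => basisVec (k + a) := by
  rw [orthonormal_iff_ite]
  intro i j
  split_ifs with h
  · exact inner_basisVec_eq (by rw [h])
  · exact inner_basisVec_ne (by simpa using h)

/-- The translation of `ℓ²(ℤ)` by `a` sites. -/
def latticeShift (a : ℤ) : LatticeSpace →ₗᵢ[ℂ] LatticeSpace :=
  (orthonormal_basisVec_add a).orthogonalFamily.linearIsometry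

theorem latticeShift_basisVec (a k : ℤ) : latticeShift a (basisVec k) = basisVec (k + a) := by
  rw [latticeShift, basisVec, OrthogonalFamily.linearIsometry_apply_single]
  simp

theorem latticeShift_column (η : ℤ → PhaseTorus) (m k : ℤ) :
    latticeShift (2 * m) (column r t (fun i => η (i + 2 * m)) k) = column r t η (k + 2 * m) := by
  have hp : Even (k + 2 * m) ↔ Even k := by simp [Int.even_add]
  simp only [column, hp]
  split_ifs <;> simp only [map_add, map_smul, latticeShift_basisVec] <;> ring_nf

/-- Covariance: an even translation respects the two kinds of columns, so it intertwines `U` for the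
shifted phases with `U` for the original ones. -/
theorem randomU_pow_basisVec_add (m : ℤ) (ω : ℤ → PhaseTorus) (n : ℕ) (k : ℤ) :
    (randomU hrt ω ^ n) (basisVec (k + 2 * m))
      = latticeShift (2 * m) ((randomU hrt (shiftPhases m ω) ^ n) (basisVec k)) := by
  induction n generalizing k with
  | zero => simp [latticeShift_basisVec]
  | succ n ih =>
    have ih' : ∀ j i : ℤ, j = i + 2 * m → (randomU hrt ω ^ n) (basisVec j)
      = latticeShift (2 * m) ((randomU hrt (shiftPhases m ω) ^ n) (basisVec i)) := by
      rintro _ i rfl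
      exact ih i
    have hη : etaPhase (shiftPhases m ω) = fun i => etaPhase ω (i + 2 * m) :=
      funext (etaPhase_shiftPhases m ω)
    rw [randomU_pow_succ_basisVec, randomU_pow_succ_basisVec, hη, ← latticeShift_column]
    simp only [column]
    split_ifs <;> simp only [map_add, map_smul, latticeShift_basisVec, ih]

/-! ### Diagonal entries of functions of the operator -/

/-- The diagonal entry `⟨φ_j, f(U_ω) φ_j⟩`. -/
def diagEntry (f : ℂ → ℂ) (j : ℤ) (ω : ℤ → PhaseTorus) : ℂ :=
  ⟪basisVec j, cfc f (randomU hrt ω) (basisVec j)⟫_ℂ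

theorem isStarNormal_randomU (ω : ℤ → PhaseTorus) : IsStarNormal (randomU hrt ω) := by
  have h := randomU_mem_unitary hrt ω
  exact ⟨by rw [commute_iff_eq, Unitary.star_mul_self_of_mem h, Unitary.mul_star_self_of_mem h]⟩

theorem spectrum_randomU_subset (ω : ℤ → PhaseTorus) :
    spectrum ℂ (randomU hrt ω) ⊆ Metric.sphere 0 1 :=
  spectrum.subset_circle_of_unitary (randomU_mem_unitary hrt ω)

theorem norm_basisVec (j : ℤ) : ‖basisVec j‖ = 1 := by
  simp [basisVec]

theorem norm_inner_basisVec_le (j : ℤ) (A : LatticeSpace →L[ℂ] LatticeSpace) :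
    ‖⟪basisVec j, A (basisVec j)⟫_ℂ‖ ≤ ‖A‖ := by
  refine (norm_inner_le_norm _ _).trans ?_
  rw [norm_basisVec, one_mul]
  simpa [norm_basisVec] using A.le_opNorm (basisVec j)

variable {f g : ℂ → ℂ}

theorem norm_diagEntry_le {B : ℝ} (hB : ∀ z ∈ Metric.sphere (0 : ℂ) 1, ‖f z‖ ≤ B)
    (j : ℤ) (ω : ℤ → PhaseTorus) : ‖diagEntry hrt f j ω‖ ≤ B :=
  (norm_inner_basisVec_le _ _).trans <|
    norm_cfc_le ((norm_nonneg _).trans (hB 1 (by simp)))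
      fun z hz => hB z (spectrum_randomU_subset hrt ω hz)

theorem diagEntry_congr (h : Set.EqOn f g (Metric.sphere 0 1)) (j : ℤ) (ω : ℤ → PhaseTorus) :
    diagEntry hrt f j ω = diagEntry hrt g j ω := by
  rw [diagEntry, diagEntry, cfc_congr (h.mono (spectrum_randomU_subset hrt ω))]

theorem diagEntry_sub (hf : ContinuousOn f (Metric.sphere 0 1))
    (hg : ContinuousOn g (Metric.sphere 0 1)) (j : ℤ) (ω : ℤ → PhaseTorus) :
    diagEntry hrt (fun z => f z - g z) j ω = diagEntry hrt f j ω - diagEntry hrt g j ω := by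
  have hs := spectrum_randomU_subset hrt ω
  rw [diagEntry, cfc_sub f g _ (hf.mono hs) (hg.mono hs), sub_apply,
    inner_sub_right, diagEntry, diagEntry]

theorem diagEntry_add (hf : ContinuousOn f (Metric.sphere 0 1))
    (hg : ContinuousOn g (Metric.sphere 0 1)) (j : ℤ) (ω : ℤ → PhaseTorus) :
    diagEntry hrt (fun z => f z + g z) j ω = diagEntry hrt f j ω + diagEntry hrt g j ω := by
  have hs := spectrum_randomU_subset hrt ω
  rw [diagEntry, cfc_add _ f g (hf.mono hs) (hg.mono hs), add_apply,
    inner_add_right, diagEntry, diagEntry]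

theorem diagEntry_const_mul (c : ℂ) (hf : ContinuousOn f (Metric.sphere 0 1))
    (j : ℤ) (ω : ℤ → PhaseTorus) :
    diagEntry hrt (fun z => c * f z) j ω = c * diagEntry hrt f j ω := by
  have hs := spectrum_randomU_subset hrt ω
  rw [diagEntry, cfc_const_mul c f _ (hf.mono hs), smul_apply,
    inner_smul_right, diagEntry]

theorem diagEntry_star (j : ℤ) (ω : ℤ → PhaseTorus) :
    diagEntry hrt (fun z => star (f z)) j ω = star (diagEntry hrt f j ω) := by
  rw [diagEntry, cfc_star, ContinuousLinearMap.star_eq_adjoint,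
    ContinuousLinearMap.adjoint_inner_right, diagEntry, ← inner_conj_symm]
  rfl

theorem diagEntry_one (j : ℤ) (ω : ℤ → PhaseTorus) :
    diagEntry hrt (fun _ => 1) j ω = 1 := by
  have := isStarNormal_randomU hrt ω
  rw [diagEntry, cfc_const_one ℂ _]
  exact inner_basisVec_eq rfl

theorem diagEntry_pow (n : ℕ) (j : ℤ) (ω : ℤ → PhaseTorus) :
    diagEntry hrt (fun z => z ^ n) j ω
      = ⟪basisVec j, (randomU hrt ω ^ n) (basisVec j)⟫_ℂ := by
  rw [diagEntry, cfc_pow_id _ _ (isStarNormal_randomU hrt ω)]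

/-- Source of the positivity of the mean, and of its faithfulness: mean zero will force `f(U_ω) φ_j
= 0` almost surely. -/
theorem diagEntry_sq (hf : ContinuousOn f (Metric.sphere 0 1)) (j : ℤ) (ω : ℤ → PhaseTorus) :
    diagEntry hrt (fun z => star (f z) * f z) j ω
      = ((‖cfc f (randomU hrt ω) (basisVec j)‖ ^ 2 : ℝ) : ℂ) := by
  have hs := hf.mono (spectrum_randomU_subset hrt ω)
  rw [diagEntry, cfc_mul _ f _ hs.star hs, cfc_star, mul_apply_eq_comp,
    ContinuousLinearMap.star_eq_adjoint, ContinuousLinearMap.adjoint_inner_right,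
    inner_self_eq_norm_sq_to_K]
  push_cast
  rfl

/-- On the unit circle the inverse is the conjugate, so negative powers reduce to positive ones. -/
theorem eqOn_zpow_neg (n : ℕ) :
    Set.EqOn (fun z : ℂ => z ^ (-(n : ℤ))) (fun z => star (z ^ n)) (Metric.sphere 0 1) := by
  intro z hz
  have hz' : ‖z‖ = 1 := by simpa using hz
  simp only [zpow_neg, zpow_natCast]
  rw [Complex.inv_def, Complex.normSq_eq_norm_sq, norm_pow, hz']
  simp

theorem diagEntry_zpow_neg (n : ℕ) (j : ℤ) (ω : ℤ → PhaseTorus) :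
    diagEntry hrt (fun z => z ^ (-(n : ℤ))) j ω = star (diagEntry hrt (fun z => z ^ n) j ω) := by
  rw [diagEntry_congr hrt (eqOn_zpow_neg n), diagEntry_star]

theorem continuousOn_zpow_sphere (p : ℤ) :
    ContinuousOn (fun z : ℂ => z ^ p) (Metric.sphere 0 1) :=
  continuousOn_id.zpow₀ p fun z hz => Or.inl (by rintro rfl; simp at hz)

theorem continuous_diagEntry_zpow (p j : ℤ) :
    Continuous (diagEntry hrt (fun z => z ^ p) j) := by
  have h : ∀ n : ℕ, Continuous (diagEntry hrt (fun z => z ^ n) j) := fun n => by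
    simp only [funext (diagEntry_pow hrt n j)]
    exact continuous_const.inner (continuous_randomU_pow_basisVec hrt n j)
  rcases Int.eq_nat_or_neg p with ⟨n, rfl | rfl⟩
  · simpa using h n
  · simp only [funext (diagEntry_zpow_neg hrt n j)]
    exact (h n).star

theorem dependsOn_diagEntry_zpow (p j : ℤ) :
    DependsOn (diagEntry hrt (fun z => z ^ p) j)
      (Set.Icc (2 * j - 4 * |p|) (2 * j + 4 * |p|)) := by
  have h : ∀ n : ℕ, DependsOn (diagEntry hrt (fun z => z ^ n) j)
      (Set.Icc (2 * j - 4 * n) (2 * j + 4 * n)) := fun n ω ω' hω => by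
    simp only [diagEntry_pow]
    rw [show (randomU hrt ω ^ n) (basisVec j) = _ from dependsOn_randomU_pow_basisVec hrt n j hω]
  rcases Int.eq_nat_or_neg p with ⟨n, rfl | rfl⟩
  · simpa using h n
  · intro ω ω' hω
    rw [diagEntry_zpow_neg, diagEntry_zpow_neg, h n (by simpa using hω)]

theorem diagEntry_zpow_add (p j m : ℤ) (ω : ℤ → PhaseTorus) :
    diagEntry hrt (fun z => z ^ p) (j + 2 * m) ω
      = diagEntry hrt (fun z => z ^ p) j (shiftPhases m ω) := by
  have h : ∀ n : ℕ, diagEntry hrt (fun z => z ^ n) (j + 2 * m) ω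
      = diagEntry hrt (fun z => z ^ n) j (shiftPhases m ω) := fun n => by
    rw [diagEntry_pow, diagEntry_pow, randomU_pow_basisVec_add, ← latticeShift_basisVec,
      LinearIsometry.inner_map_map]
  rcases Int.eq_nat_or_neg p with ⟨n, rfl | rfl⟩
  · simpa using h n
  · rw [diagEntry_zpow_neg, diagEntry_zpow_neg, h]

/-! ### Approximation by trigonometric polynomials -/

instance fact_two_pi_pos : Fact (0 < 2 * Real.pi) := ⟨Real.two_pi_pos⟩

theorem expI_mem_sphere (x : PhaseTorus) : expI x ∈ Metric.sphere (0 : ℂ) 1 := by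
  rw [mem_sphere_zero_iff_norm]
  exact Circle.norm_coe _

theorem exists_expI_eq {z : ℂ} (hz : z ∈ Metric.sphere (0 : ℂ) 1) : ∃ x, expI x = z := by
  refine ⟨(Complex.arg z : PhaseTorus), ?_⟩
  rw [expI, AddCircle.toCircle_apply_mk]
  have h := Complex.norm_mul_exp_arg_mul_I z
  rw [mem_sphere_zero_iff_norm.1 hz] at h
  rw [div_self Real.two_pi_pos.ne', one_mul, Circle.coe_exp]
  simpa using h

/-- Pulled back to the torus, this is the uniform density of the span of the Fourier characters. -/
theorem exists_laurent_approx (hf : ContinuousOn f (Metric.sphere 0 1)) {ε : ℝ} (hε : 0 < ε) :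
    ∃ (s : Finset ℤ) (c : ℤ → ℂ), ∀ z ∈ Metric.sphere (0 : ℂ) 1,
      ‖f z - ∑ p ∈ s, c p * z ^ p‖ ≤ ε := by
  let F : C(PhaseTorus, ℂ) := ⟨fun x => f (expI x),
    hf.comp_continuous continuous_expI expI_mem_sphere⟩
  have hF : F ∈ (Submodule.span ℂ (Set.range (@fourier (2 * Real.pi)))).topologicalClosure := by
    rw [span_fourier_closure_eq_top]
    trivial
  obtain ⟨G, hG, hd⟩ := Metric.mem_closure_iff.1 hF ε hε
  obtain ⟨c, rfl⟩ := (Finsupp.mem_span_range_iff_exists_finsupp).1 hG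
  refine ⟨c.support, c, fun z hz => ?_⟩
  obtain ⟨x, rfl⟩ := exists_expI_eq hz
  rw [dist_eq_norm] at hd
  have h := (ContinuousMap.norm_coe_le_norm _ x).trans hd.le
  convert! h using 2
  simp only [ContinuousMap.sub_apply, Finsupp.sum, ContinuousMap.coe_sum, Finset.sum_apply,
    ContinuousMap.smul_apply, fourier_apply, AddCircle.toCircle_zsmul, Circle.coe_zpow,
    smul_eq_mul]
  rfl

theorem continuousOn_laurent (s : Finset ℤ) (c : ℤ → ℂ) :
    ContinuousOn (fun z : ℂ => ∑ p ∈ s, c p * z ^ p) (Metric.sphere 0 1) :=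
  continuousOn_finsetSum _ fun p _ => continuousOn_const.mul (continuousOn_zpow_sphere p)

theorem diagEntry_laurent (s : Finset ℤ) (c : ℤ → ℂ) (j : ℤ) (ω : ℤ → PhaseTorus) :
    diagEntry hrt (fun z => ∑ p ∈ s, c p * z ^ p) j ω
      = ∑ p ∈ s, c p * diagEntry hrt (fun z => z ^ p) j ω := by
  induction s using Finset.induction_on with
  | empty =>
    simpa using diagEntry_const_mul hrt 0 (f := fun _ => 1) continuousOn_const j ω
  | insert a s ha ih =>
    simp only [Finset.sum_insert ha]
    rw [diagEntry_add hrt (f := fun z => c a * z ^ a)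
      (continuousOn_const.mul (continuousOn_zpow_sphere a)) (continuousOn_laurent s c), ih, diagEntry_const_mul hrt _ (continuousOn_zpow_sphere a)]

theorem norm_diagEntry_sub_le {ε : ℝ} (hf : ContinuousOn f (Metric.sphere 0 1))
    (hg : ContinuousOn g (Metric.sphere 0 1))
    (h : ∀ z ∈ Metric.sphere (0 : ℂ) 1, ‖f z - g z‖ ≤ ε) (j : ℤ) (ω : ℤ → PhaseTorus) :
    ‖diagEntry hrt f j ω - diagEntry hrt g j ω‖ ≤ ε := by
  rw [← diagEntry_sub hrt hf hg]
  exact norm_diagEntry_le hrt h j ω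

/-- A uniform limit, over all `ω`, of the entries of Laurent polynomials. It also supplies the
measurability used in the integrals. -/
theorem continuous_diagEntry (hf : ContinuousOn f (Metric.sphere 0 1)) (j : ℤ) :
    Continuous (diagEntry hrt f j) := by
  refine continuous_of_uniform_approx_of_continuous fun u hu => ?_
  obtain ⟨ε, hε, hu⟩ := Metric.mem_uniformity_dist.1 hu
  obtain ⟨s, c, h⟩ := exists_laurent_approx hf (half_pos hε)
  refine ⟨diagEntry hrt (fun z => ∑ p ∈ s, c p * z ^ p) j, ?_, fun ω => hu ?_⟩
  · simp only [funext (diagEntry_laurent hrt s c j)]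
    exact continuous_finsetSum _ fun p _ => continuous_const.mul (continuous_diagEntry_zpow hrt p j)
  · rw [dist_eq_norm]
    exact (norm_diagEntry_sub_le hrt hf (continuousOn_laurent s c) h j ω).trans_lt
      (half_lt_self hε)

theorem diagEntry_add_two_mul (hf : ContinuousOn f (Metric.sphere 0 1)) (j m : ℤ)
    (ω : ℤ → PhaseTorus) :
    diagEntry hrt f (j + 2 * m) ω = diagEntry hrt f j (shiftPhases m ω) := by
  refine eq_of_forall_dist_le fun ε hε => ?_
  obtain ⟨s, c, h⟩ := exists_laurent_approx hf (half_pos hε)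
  have h1 := norm_diagEntry_sub_le hrt hf (continuousOn_laurent s c) h (j + 2 * m) ω
  have h2 := norm_diagEntry_sub_le hrt hf (continuousOn_laurent s c) h j (shiftPhases m ω)
  have h3 : diagEntry hrt (fun z => ∑ p ∈ s, c p * z ^ p) (j + 2 * m) ω
      = diagEntry hrt (fun z => ∑ p ∈ s, c p * z ^ p) j (shiftPhases m ω) := by
    simp only [diagEntry_laurent, diagEntry_zpow_add]
  rw [← dist_eq_norm] at h1 h2
  rw [h3] at h1
  rw [dist_comm] at h2
  linarith [dist_triangle (diagEntry hrt f (j + 2 * m) ω)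
    (diagEntry hrt (fun z => ∑ p ∈ s, c p * z ^ p) j (shiftPhases m ω))
    (diagEntry hrt f j (shiftPhases m ω))]

end

end RandomUnitary

namespace RandomUnitary

noncomputable section

/-! ### Independence and stationarity of the phases -/

section Phases

variable (P₀ P₁ : Measure PhaseTorus) [IsProbabilityMeasure P₀] [IsProbabilityMeasure P₁]

instance isProbabilityMeasure_phaseLaw : IsProbabilityMeasure (phaseLaw P₀ P₁) := by
  unfold phaseLaw
  infer_instance

/-- The shift `4 * m` is even, so it preserves the parity that selects the law of each coordinate.
-/
theorem measurePreserving_shiftPhases (m : ℤ) :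
    MeasurePreserving (shiftPhases m) (phaseLaw P₀ P₁) (phaseLaw P₀ P₁) := by
  refine ⟨measurable_pi_iff.2 fun i => measurable_pi_apply _, ?_⟩
  have h : (fun i : ℤ => coordLaw P₀ P₁ (i + 4 * m)) = coordLaw P₀ P₁ := by
    funext i
    have hp : Even (i + 4 * m) ↔ Even i := by
      rw [Int.even_add, iff_comm]
      exact ⟨fun h => ⟨fun _ => ⟨2 * m, by ring⟩, fun _ => h⟩, fun h => h.2 ⟨2 * m, by ring⟩⟩
    simp only [coordLaw, hp]
  have h2 := Measure.map_infinitePi_infinitePi_of_inj (P := coordLaw P₀ P₁)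
    (f := fun i : ℤ => i + 4 * m) (add_left_injective _)
  exact h2.trans (congrArg Measure.infinitePi h)

variable {P₀ P₁}

theorem indepFun_of_dependsOn {X Y : (ℤ → PhaseTorus) → ℂ} (hX : Measurable X)
    (hY : Measurable Y) {S T : Finset ℤ} (hXS : DependsOn X S) (hYT : DependsOn Y T)
    (hST : Disjoint S T) : ProbabilityTheory.IndepFun X Y (phaseLaw P₀ P₁) := by
  have h := (ProbabilityTheory.iIndepFun_infinitePi (P := coordLaw P₀ P₁)
    (X := fun _ x => x) (fun _ => measurable_id)).indepFun_finset S T hST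
    fun i => measurable_pi_apply i
  -- Extending by `0` off `R` factors a function through the restriction to `R`; the value `0` is
  -- immaterial, as the function depends on `R` only.
  let ext (R : Finset ℤ) (v : R → PhaseTorus) (i : ℤ) : PhaseTorus :=
    if hi : i ∈ R then v ⟨i, hi⟩ else 0
  have hext : ∀ R : Finset ℤ, Measurable (ext R) := fun R => measurable_pi_iff.2 fun i => by
    by_cases hi : i ∈ R
    · simpa only [ext, hi, dite_true] using measurable_pi_apply _
    · simpa only [ext, hi, dite_false] using measurable_const
  have key : ∀ (Z : (ℤ → PhaseTorus) → ℂ) (R : Finset ℤ), DependsOn Z R →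
      Z = (Z ∘ ext R) ∘ fun ω (i : R) => ω i := by
    intro Z R hZ
    funext ω
    refine hZ fun i hi => ?_
    have hi' : i ∈ R := hi
    simp [ext, hi']
  rw [key X S hXS, key Y T hYT]
  exact h.comp (hX.comp (hext S)) (hY.comp (hext T))

end Phases

variable {r t : ℝ} (hrt : r ^ 2 + t ^ 2 = 1)
variable (P₀ P₁ : Measure PhaseTorus) [IsProbabilityMeasure P₀] [IsProbabilityMeasure P₁]
variable {f g : ℂ → ℂ}

/-! ### Mean diagonal entries -/

theorem exists_bound_on_sphere (hf : ContinuousOn f (Metric.sphere 0 1)) :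
    ∃ B, ∀ z ∈ Metric.sphere (0 : ℂ) 1, ‖f z‖ ≤ B :=
  (isCompact_sphere (0 : ℂ) 1).exists_bound_of_continuousOn hf

theorem integrable_diagEntry (hf : ContinuousOn f (Metric.sphere 0 1)) (j : ℤ) :
    Integrable (diagEntry hrt f j) (phaseLaw P₀ P₁) := by
  obtain ⟨B, hB⟩ := exists_bound_on_sphere hf
  exact Integrable.of_bound (continuous_diagEntry hrt hf j).aestronglyMeasurable B
    (ae_of_all _ (norm_diagEntry_le hrt hB j))

/-- The expectation of `⟨φ_j, f(U_ω) φ_j⟩`. -/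
def entryMean (f : ℂ → ℂ) (j : ℤ) : ℂ := ∫ ω, diagEntry hrt f j ω ∂(phaseLaw P₀ P₁)

theorem entryMean_add_two_mul (hf : ContinuousOn f (Metric.sphere 0 1)) (j m : ℤ) :
    entryMean hrt P₀ P₁ f (j + 2 * m) = entryMean hrt P₀ P₁ f j := by
  have h := measurePreserving_shiftPhases P₀ P₁ m
  rw [entryMean, entryMean]
  simp only [diagEntry_add_two_mul hrt hf]
  rw [← integral_map h.measurable.aemeasurable, h.map_eq]
  rw [h.map_eq]
  exact (continuous_diagEntry hrt hf j).aestronglyMeasurable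

theorem sum_range_entryMean (hf : ContinuousOn f (Metric.sphere 0 1)) (K : ℕ) :
    ∑ s ∈ Finset.range (2 * K), entryMean hrt P₀ P₁ f s
      = K * (entryMean hrt P₀ P₁ f 0 + entryMean hrt P₀ P₁ f 1) := by
  induction K with
  | zero => simp
  | succ K ih =>
    have h0 : entryMean hrt P₀ P₁ f ((2 * K : ℕ) : ℤ) = entryMean hrt P₀ P₁ f 0 := by
      rw [← entryMean_add_two_mul hrt P₀ P₁ hf 0 K]
      congr 1
      push_cast
      ring
    have h1 : entryMean hrt P₀ P₁ f ((2 * K + 1 : ℕ) : ℤ) = entryMean hrt P₀ P₁ f 1 := by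
      rw [← entryMean_add_two_mul hrt P₀ P₁ hf 1 K]
      congr 1
      push_cast
      ring
    rw [Nat.mul_succ, Finset.sum_range_succ, Finset.sum_range_succ, ih, h0, h1]
    push_cast
    ring

theorem sum_range_entryMean_neg (hf : ContinuousOn f (Metric.sphere 0 1)) (K : ℕ) :
    ∑ s ∈ Finset.range (2 * K), entryMean hrt P₀ P₁ f (-1 - s)
      = K * (entryMean hrt P₀ P₁ f 0 + entryMean hrt P₀ P₁ f 1) := by
  induction K with
  | zero => simp
  | succ K ih =>
    have h0 : entryMean hrt P₀ P₁ f (-1 - ((2 * K : ℕ) : ℤ)) = entryMean hrt P₀ P₁ f 1 := by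
      rw [← entryMean_add_two_mul hrt P₀ P₁ hf 1 (-1 - K)]
      congr 1
      push_cast
      ring
    have h1 : entryMean hrt P₀ P₁ f (-1 - ((2 * K + 1 : ℕ) : ℤ)) = entryMean hrt P₀ P₁ f 0 := by
      rw [← entryMean_add_two_mul hrt P₀ P₁ hf 0 (-1 - K)]
      congr 1
      push_cast
      ring
    rw [Nat.mul_succ, Finset.sum_range_succ, Finset.sum_range_succ, ih, h0, h1]
    push_cast
    ring

/-- The mean of `f` for the density of states. -/
def stateMean (f : ℂ → ℂ) : ℂ := (entryMean hrt P₀ P₁ f 0 + entryMean hrt P₀ P₁ f 1) / 2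

theorem norm_entryMean_sub_le {ε : ℝ} (hf : ContinuousOn f (Metric.sphere 0 1))
    (hg : ContinuousOn g (Metric.sphere 0 1))
    (h : ∀ z ∈ Metric.sphere (0 : ℂ) 1, ‖f z - g z‖ ≤ ε) (j : ℤ) :
    ‖entryMean hrt P₀ P₁ f j - entryMean hrt P₀ P₁ g j‖ ≤ ε := by
  rw [entryMean, entryMean, ← integral_sub (integrable_diagEntry hrt P₀ P₁ hf j)
    (integrable_diagEntry hrt P₀ P₁ hg j)]
  simpa using norm_integral_le_of_norm_le_const (μ := phaseLaw P₀ P₁)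
    (ae_of_all _ (norm_diagEntry_sub_le hrt hf hg h j))

theorem norm_stateMean_sub_le {ε : ℝ} (hf : ContinuousOn f (Metric.sphere 0 1))
    (hg : ContinuousOn g (Metric.sphere 0 1))
    (h : ∀ z ∈ Metric.sphere (0 : ℂ) 1, ‖f z - g z‖ ≤ ε) :
    ‖stateMean hrt P₀ P₁ f - stateMean hrt P₀ P₁ g‖ ≤ ε := by
  have h0 := norm_entryMean_sub_le hrt P₀ P₁ hf hg h 0
  have h1 := norm_entryMean_sub_le hrt P₀ P₁ hf hg h 1
  have h2 : stateMean hrt P₀ P₁ f - stateMean hrt P₀ P₁ g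
      = ((entryMean hrt P₀ P₁ f 0 - entryMean hrt P₀ P₁ g 0)
        + (entryMean hrt P₀ P₁ f 1 - entryMean hrt P₀ P₁ g 1)) / 2 := by
    rw [stateMean, stateMean]
    ring
  rw [h2, norm_div]
  have h3 := norm_add_le (entryMean hrt P₀ P₁ f 0 - entryMean hrt P₀ P₁ g 0)
    (entryMean hrt P₀ P₁ f 1 - entryMean hrt P₀ P₁ g 1)
  rw [show ‖(2 : ℂ)‖ = 2 by simp]
  linarith

theorem entryMean_laurent (s : Finset ℤ) (c : ℤ → ℂ) (j : ℤ) :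
    entryMean hrt P₀ P₁ (fun z => ∑ p ∈ s, c p * z ^ p) j
      = ∑ p ∈ s, c p * entryMean hrt P₀ P₁ (fun z => z ^ p) j := by
  simp only [entryMean, diagEntry_laurent]
  rw [integral_finsetSum _ fun p _ =>
    (integrable_diagEntry hrt P₀ P₁ (continuousOn_zpow_sphere p) j).const_mul (c p)]
  simp only [integral_const_mul]

theorem stateMean_laurent (s : Finset ℤ) (c : ℤ → ℂ) :
    stateMean hrt P₀ P₁ (fun z => ∑ p ∈ s, c p * z ^ p)
      = ∑ p ∈ s, c p * stateMean hrt P₀ P₁ (fun z => z ^ p) := by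
  simp only [stateMean, entryMean_laurent, ← Finset.sum_add_distrib, Finset.sum_div]
  exact Finset.sum_congr rfl fun p _ => by ring

/-! ### The law of large numbers -/

/-- The sites are `2(2|p| + 1)` apart: an even step for stationarity, and long enough to separate
the blocks of phases. The sign `σ` chooses the half-line. -/
theorem ae_averageTo_diagEntry_zpow (p s σ : ℤ) (hσ : |σ| = 1) :
    ∀ᵐ ω ∂(phaseLaw P₀ P₁), AverageTo
      (fun q : ℕ => diagEntry hrt (fun z => z ^ p) (s + 2 * ((2 * |p| + 1) * (σ * q))) ω)
      (entryMean hrt P₀ P₁ (fun z => z ^ p) s) := by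
  set j : ℕ → ℤ := fun q => s + 2 * ((2 * |p| + 1) * (σ * q)) with hj
  have hc := continuous_diagEntry_zpow hrt p
  have hdep : ∀ q, DependsOn (diagEntry hrt (fun z => z ^ p) (j q))
      (Finset.Icc (2 * j q - 4 * |p|) (2 * j q + 4 * |p|)) := fun q => by
    rw [Finset.coe_Icc]
    exact dependsOn_diagEntry_zpow hrt p (j q)
  have hj0 : j 0 = s := by simp [hj]
  have hslln := ProbabilityTheory.strong_law_ae (μ := phaseLaw P₀ P₁)
    (fun q => diagEntry hrt (fun z => z ^ p) (j q))
    (integrable_diagEntry hrt P₀ P₁ (continuousOn_zpow_sphere p) _) ?_ ?_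
  · rw [hj0] at hslln
    filter_upwards [hslln] with ω hω
    exact averageTo_of_tendsto hω
  · intro q q' hq
    refine indepFun_of_dependsOn (hc _).measurable (hc _).measurable (hdep q) (hdep q') ?_
    rw [Finset.disjoint_left]
    intro i hi hi'
    rw [Finset.mem_Icc] at hi hi'
    -- Two blocks of radius `4|p|` that meet have centres within `8|p|`, while distinct centres
    -- differ by at least `8|p| + 4`.
    have h1 : |2 * (j q - j q')| ≤ 8 * |p| := abs_le.2 ⟨by omega, by omega⟩
    have h2 : 2 * (j q - j q') = 4 * ((2 * |p| + 1) * (σ * ((q : ℤ) - q'))) := by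
      simp only [hj]
      ring
    have h3 : 1 ≤ |(q : ℤ) - q'| := Int.one_le_abs (by omega)
    rw [h2, abs_mul, abs_mul, abs_mul, hσ, one_mul, abs_of_nonneg (by positivity : (0:ℤ) ≤ 4),
      abs_of_nonneg (by positivity : 0 ≤ 2 * |p| + 1)] at h1
    nlinarith [abs_nonneg p]
  · intro q
    have h := measurePreserving_shiftPhases P₀ P₁ ((2 * |p| + 1) * (σ * q))
    have h1 : diagEntry hrt (fun z => z ^ p) (j q) = diagEntry hrt (fun z => z ^ p) s
        ∘ shiftPhases ((2 * |p| + 1) * (σ * q)) := by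
      funext ω
      exact diagEntry_zpow_add hrt p s _ ω
    refine ⟨(hc _).aemeasurable, (hc _).aemeasurable, ?_⟩
    rw [h1, hj0, ← Measure.map_map (hc s).measurable h.measurable, h.map_eq]

theorem ae_averageTo_zpow (p : ℤ) :
    ∀ᵐ ω ∂(phaseLaw P₀ P₁),
      AverageTo (fun n : ℕ => diagEntry hrt (fun z => z ^ p) n ω)
        (stateMean hrt P₀ P₁ (fun z => z ^ p)) ∧
      AverageTo (fun n : ℕ => diagEntry hrt (fun z => z ^ p) (-1 - n) ω)
        (stateMean hrt P₀ P₁ (fun z => z ^ p)) := by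
  have h₁ := ae_all_iff.2 fun s : ℤ => ae_averageTo_diagEntry_zpow hrt P₀ P₁ p s 1 (by simp)
  have h₂ := ae_all_iff.2 fun s : ℤ => ae_averageTo_diagEntry_zpow hrt P₀ P₁ p s (-1) (by simp)
  have hf := continuousOn_zpow_sphere p
  obtain ⟨B, hB⟩ := exists_bound_on_sphere hf
  -- The step is `2 * K` sites. Each parity occurs `K` times among the residues, so the residue
  -- means average to `stateMean`.
  set K : ℕ := 2 * p.natAbs + 1 with hKdef
  have hK : (2 * |p| + 1 : ℤ) = K := by
    rw [hKdef]
    push_cast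
    rfl
  have hL : 0 < 2 * K := by omega
  filter_upwards [h₁, h₂] with ω h₁ h₂
  rw [hK] at h₁ h₂
  constructor
  · refine AverageTo.of_residues (fun n => norm_diagEntry_le hrt hB _ ω) hL
      (e := fun s => entryMean hrt P₀ P₁ (fun z => z ^ p) s) (fun s _ => ?_) ?_
    · convert! h₁ s using 2 with q
      congr 1
      push_cast
      ring
    · rw [sum_range_entryMean hrt P₀ P₁ hf, stateMean]
      push_cast
      ring
  · refine AverageTo.of_residues (fun n => norm_diagEntry_le hrt hB _ ω) hL
      (e := fun s => entryMean hrt P₀ P₁ (fun z => z ^ p) (-1 - s)) (fun s _ => ?_) ?_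
    · convert! h₂ (-1 - s) using 2 with q
      congr 1
      push_cast
      ring
    · rw [sum_range_entryMean_neg hrt P₀ P₁ hf, stateMean]
      push_cast
      ring

/-! ### Window averages for all continuous functions, and traces -/

theorem norm_sum_Ioc_div_le {y : ℤ → ℂ} {ε : ℝ} (hε : 0 ≤ ε) (hy : ∀ j, ‖y j‖ ≤ ε) (M N : ℤ) :
    ‖(∑ j ∈ Finset.Ioc M N, y j) / ((N : ℂ) - M)‖ ≤ ε := by
  rcases le_or_gt N M with h | h
  · simpa [Finset.Ioc_eq_empty_of_le h] using hε
  · have hc : ((N : ℂ) - M) = (((N - M : ℤ) : ℝ) : ℂ) := by push_cast; rfl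
    have h0 : (0 : ℝ) < ((N - M : ℤ) : ℝ) := by exact_mod_cast (by omega : 0 < N - M)
    rw [norm_div, hc, Complex.norm_real, Real.norm_of_nonneg h0.le, div_le_iff₀ h0]
    refine (norm_sum_le_of_le _ fun j _ => hy j).trans (le_of_eq ?_)
    rw [Finset.sum_const, Int.card_Ioc, nsmul_eq_mul, mul_comm]
    congr 1
    have : (((N - M).toNat : ℕ) : ℤ) = N - M := by omega
    exact_mod_cast congrArg (Int.cast : ℤ → ℝ) this

/-- The null set comes from the countably many integer powers alone, so it is independent of `f` and
`C`. This uniformity lets `f` depend on `ω` in `ae_subset_spectrum`. -/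
theorem ae_tendsto_boxAverage :
    ∀ᵐ ω ∂(phaseLaw P₀ P₁), ∀ f : ℂ → ℂ, ContinuousOn f (Metric.sphere 0 1) → ∀ C : ℝ,
      Tendsto (fun p : ℤ × ℤ =>
          (∑ j ∈ Finset.Ioc p.1 p.2, diagEntry hrt f j ω) / ((p.2 : ℂ) - (p.1 : ℂ)))
        (boxFilter C) (𝓝 (stateMean hrt P₀ P₁ f)) := by
  filter_upwards [ae_all_iff.2 (ae_averageTo_zpow hrt P₀ P₁)] with ω hω f hf C
  rw [Metric.tendsto_nhds]
  intro δ hδ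
  obtain ⟨s, c, hsc⟩ := exists_laurent_approx hf (by positivity : 0 < δ / 3)
  have hg := continuousOn_laurent s c
  set g : ℂ → ℂ := fun z => ∑ p ∈ s, c p * z ^ p with hgdef
  have hlim : Tendsto (fun p : ℤ × ℤ =>
        (∑ j ∈ Finset.Ioc p.1 p.2, diagEntry hrt g j ω) / ((p.2 : ℂ) - (p.1 : ℂ)))
      (boxFilter C) (𝓝 (stateMean hrt P₀ P₁ g)) := by
    rw [hgdef, stateMean_laurent]
    have h := tendsto_finsetSum s fun p _ =>
      (tendsto_boxFilter_average (y := fun j => diagEntry hrt (fun z => z ^ p) j ω)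
        (hω p).1 (hω p).2 C).const_mul (c p)
    refine h.congr fun p => ?_
    simp only [diagEntry_laurent]
    rw [Finset.sum_comm, Finset.sum_div]
    exact Finset.sum_congr rfl fun q _ => by rw [← Finset.mul_sum, mul_div_assoc]
  filter_upwards [(Metric.tendsto_nhds.1 hlim) (δ / 3) (by positivity)] with p hp
  have h1 : dist ((∑ j ∈ Finset.Ioc p.1 p.2, diagEntry hrt f j ω) / ((p.2 : ℂ) - (p.1 : ℂ)))
      ((∑ j ∈ Finset.Ioc p.1 p.2, diagEntry hrt g j ω) / ((p.2 : ℂ) - (p.1 : ℂ))) ≤ δ / 3 := by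
    rw [dist_eq_norm, ← sub_div, ← Finset.sum_sub_distrib]
    exact norm_sum_Ioc_div_le (by positivity)
      (fun j => norm_diagEntry_sub_le hrt hf hg hsc j ω) _ _
  have h2 := norm_stateMean_sub_le hrt P₀ P₁ hf hg hsc
  rw [← dist_eq_norm, dist_comm] at h2
  have h3 := dist_triangle4
    ((∑ j ∈ Finset.Ioc p.1 p.2, diagEntry hrt f j ω) / ((p.2 : ℂ) - (p.1 : ℂ)))
    ((∑ j ∈ Finset.Ioc p.1 p.2, diagEntry hrt g j ω) / ((p.2 : ℂ) - (p.1 : ℂ)))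
    (stateMean hrt P₀ P₁ g) (stateMean hrt P₀ P₁ f)
  linarith

theorem latticeTrace_siteProj (A : LatticeSpace →L[ℂ] LatticeSpace) (M N : ℤ) :
    latticeTrace (siteProj M N ∘L A ∘L siteProj M N)
      = ∑ j ∈ Finset.Ioc M N, ⟪basisVec j, A (basisVec j)⟫_ℂ := by
  have hinner : ∀ (j : ℤ) (ψ : LatticeSpace), ⟪basisVec j, ψ⟫_ℂ = ψ j := fun j ψ => by
    simp [basisVec, lp.inner_single_left]
  have hproj : ∀ j ∈ Finset.Ioc M N, siteProj M N (basisVec j) = basisVec j := by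
    intro j hj
    ext k
    rw [siteProj_apply]
    split_ifs with hk
    · rfl
    · rw [basisVec, lp.single_apply_ne]
      rintro rfl
      exact hk hj
  rw [latticeTrace, tsum_eq_sum (s := Finset.Ioc M N)]
  · refine Finset.sum_congr rfl fun j hj => ?_
    rw [ContinuousLinearMap.comp_apply, ContinuousLinearMap.comp_apply, hproj j hj, hinner,
      siteProj_apply, if_pos hj, hinner]
  · intro j hj
    rw [ContinuousLinearMap.comp_apply, hinner, siteProj_apply, if_neg hj]

end

end RandomUnitary

namespace RandomUnitary

noncomputable section

open scoped CompactlySupported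

variable {r t : ℝ} (hrt : r ^ 2 + t ^ 2 = 1)
variable (P₀ P₁ : Measure PhaseTorus) [IsProbabilityMeasure P₀] [IsProbabilityMeasure P₁]
variable {f g : ℂ → ℂ}

/-! ### The density of states -/

theorem continuousOn_star_mul_self (hf : ContinuousOn f (Metric.sphere 0 1)) :
    ContinuousOn (fun z => star (f z) * f z) (Metric.sphere 0 1) :=
  hf.star.mul hf

theorem stateMean_congr (h : Set.EqOn f g (Metric.sphere 0 1)) :
    stateMean hrt P₀ P₁ f = stateMean hrt P₀ P₁ g := by
  simp only [stateMean, entryMean, diagEntry_congr hrt h]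

theorem stateMean_add (hf : ContinuousOn f (Metric.sphere 0 1))
    (hg : ContinuousOn g (Metric.sphere 0 1)) :
    stateMean hrt P₀ P₁ (fun z => f z + g z) = stateMean hrt P₀ P₁ f + stateMean hrt P₀ P₁ g := by
  have h : ∀ j, entryMean hrt P₀ P₁ (fun z => f z + g z) j
      = entryMean hrt P₀ P₁ f j + entryMean hrt P₀ P₁ g j := fun j => by
    simp only [entryMean, diagEntry_add hrt hf hg]
    exact integral_add (integrable_diagEntry hrt P₀ P₁ hf j) (integrable_diagEntry hrt P₀ P₁ hg j)
  rw [stateMean, h, h, stateMean, stateMean]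
  ring

theorem stateMean_const_mul (c : ℂ) (hf : ContinuousOn f (Metric.sphere 0 1)) :
    stateMean hrt P₀ P₁ (fun z => c * f z) = c * stateMean hrt P₀ P₁ f := by
  have h : ∀ j, entryMean hrt P₀ P₁ (fun z => c * f z) j
      = c * entryMean hrt P₀ P₁ f j := fun j => by
    simp only [entryMean, diagEntry_const_mul hrt c hf]
    exact integral_const_mul _ _
  rw [stateMean, h, h, stateMean]
  ring

theorem stateMean_star : stateMean hrt P₀ P₁ (fun z => star (f z))
    = star (stateMean hrt P₀ P₁ f) := by
  have h : ∀ j, entryMean hrt P₀ P₁ (fun z => star (f z)) j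
      = star (entryMean hrt P₀ P₁ f j) := fun j => by
    simp only [entryMean, diagEntry_star]
    exact integral_conj
  rw [stateMean, h, h, stateMean]
  simp

theorem stateMean_one : stateMean hrt P₀ P₁ (fun _ => 1) = 1 := by
  simp [stateMean, entryMean, diagEntry_one]

theorem entryMean_star_mul_self (hf : ContinuousOn f (Metric.sphere 0 1)) (j : ℤ) :
    entryMean hrt P₀ P₁ (fun z => star (f z) * f z) j
      = ((∫ ω, ‖cfc f (randomU hrt ω) (basisVec j)‖ ^ 2 ∂(phaseLaw P₀ P₁) : ℝ) : ℂ) := by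
  simp only [entryMean, diagEntry_sq hrt hf]
  exact integral_ofReal

theorem stateMean_star_mul_self (hf : ContinuousOn f (Metric.sphere 0 1)) :
    stateMean hrt P₀ P₁ (fun z => star (f z) * f z)
      = (((∫ ω, ‖cfc f (randomU hrt ω) (basisVec 0)‖ ^ 2 ∂(phaseLaw P₀ P₁)
        + ∫ ω, ‖cfc f (randomU hrt ω) (basisVec 1)‖ ^ 2 ∂(phaseLaw P₀ P₁)) / 2 : ℝ) : ℂ) := by
  rw [stateMean, entryMean_star_mul_self hrt P₀ P₁ hf, entryMean_star_mul_self hrt P₀ P₁ hf]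
  push_cast
  rfl

/-- The function on the unit circle which corresponds to a real function on the torus. -/
def circleFun (g : PhaseTorus → ℝ) (z : ℂ) : ℂ := g ((Complex.arg z : ℝ) : PhaseTorus)

/-- The jump of `Complex.arg` on the negative axis is a full turn, hence invisible in the torus. -/
theorem continuousOn_circleFun {g : PhaseTorus → ℝ} (hg : Continuous g) :
    ContinuousOn (circleFun g) (Metric.sphere 0 1) := by
  intro z hz
  have hz0 : z ≠ 0 := by
    rintro rfl
    simp at hz
  have h := Complex.continuousAt_arg_coe_angle hz0
  exact (Complex.continuous_ofReal.continuousAt.comp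
    (ContinuousAt.comp (f := fun z : ℂ => ((Complex.arg z : ℝ) : PhaseTorus))
      hg.continuousAt h)).continuousWithinAt

theorem circleFun_expI (g : PhaseTorus → ℝ) (x : PhaseTorus) : circleFun g (expI x) = g x := by
  have h : ((Complex.arg (expI x) : ℝ) : PhaseTorus) = x := by
    -- `Real.Angle` is the same quotient of `ℝ` as `PhaseTorus`, so `x` can be read as an angle.
    obtain ⟨y, hy⟩ : ∃ y : Real.Angle, y = x := ⟨x, rfl⟩
    have h1 : expI x = (y.toCircle : ℂ) := by
      induction x using QuotientAddGroup.induction_on with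
      | H s =>
        subst hy
        rw [expI, AddCircle.toCircle_apply_mk, div_self Real.two_pi_pos.ne', one_mul]
        exact congrArg Subtype.val (Real.Angle.toCircle_coe s).symm
    rw [h1, ← hy]
    exact Real.Angle.arg_toCircle y
  rw [circleFun, h]

theorem stateMean_circleFun_re {g : PhaseTorus → ℝ} :
    (((stateMean hrt P₀ P₁ (circleFun g)).re : ℝ) : ℂ) = stateMean hrt P₀ P₁ (circleFun g) := by
  refine Complex.conj_eq_iff_re.1 ?_
  refine (stateMean_star hrt P₀ P₁ (f := circleFun g)).symm.trans ?_
  exact stateMean_congr hrt P₀ P₁ fun z _ => Complex.conj_ofReal _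

/-- A nonnegative function is the square of its continuous root, so its mean is an average of
squared norms. -/
theorem stateMean_circleFun_nonneg {g : PhaseTorus → ℝ} (hg : Continuous g) (h0 : 0 ≤ g) :
    0 ≤ (stateMean hrt P₀ P₁ (circleFun g)).re := by
  have h1 : stateMean hrt P₀ P₁ (circleFun g) = stateMean hrt P₀ P₁ (fun z =>
      star (circleFun (fun x => √(g x)) z) * circleFun (fun x => √(g x)) z) := by
    refine stateMean_congr hrt P₀ P₁ fun z _ => ?_
    simp only [circleFun]
    rw [show star ((√(g ((Complex.arg z : ℝ) : PhaseTorus)) : ℝ) : ℂ) = _ from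
      Complex.conj_ofReal _, ← Complex.ofReal_mul, Real.mul_self_sqrt (h0 _)]
  rw [h1, stateMean_star_mul_self hrt P₀ P₁ (continuousOn_circleFun hg.sqrt), Complex.ofReal_re]
  positivity

/-- The positive functional which defines the density of states. -/
def stateFunctional : C_c(PhaseTorus, ℝ) →ₚ[ℝ] ℝ :=
  PositiveLinearMap.mk₀
    -- The real part loses nothing, by `stateMean_circleFun_re`.
    { toFun := fun g => (stateMean hrt P₀ P₁ (circleFun g)).re
      map_add' := fun g h => by
        rw [← Complex.add_re, ← stateMean_add hrt P₀ P₁ (continuousOn_circleFun (g := g) (map_continuous g))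
          (continuousOn_circleFun (g := h) (map_continuous h))]
        congr 2
        funext z
        simp [circleFun]
      map_smul' := fun c g => by
        have h : circleFun (c • g : C_c(PhaseTorus, ℝ)) = fun z => (c : ℂ) * circleFun g z := by
          funext z
          simp [circleFun]
        rw [h, stateMean_const_mul hrt P₀ P₁ _ (continuousOn_circleFun (g := g) (map_continuous g)),
          Complex.re_ofReal_mul]
        rfl }
    fun g hg => stateMean_circleFun_nonneg hrt P₀ P₁ g.continuous hg

/-- The density of states. -/
def stateMeasure : Measure PhaseTorus := RealRMK.rieszMeasure (stateFunctional hrt P₀ P₁)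

instance isFiniteMeasure_stateMeasure : IsFiniteMeasure (stateMeasure hrt P₀ P₁) := by
  unfold stateMeasure
  infer_instance

theorem integral_stateMeasure_real {g : PhaseTorus → ℝ} (hg : Continuous g) :
    ((∫ x, g x ∂(stateMeasure hrt P₀ P₁) : ℝ) : ℂ) = stateMean hrt P₀ P₁ (circleFun g) := by
  rw [← stateMean_circleFun_re]
  exact congrArg Complex.ofReal (RealRMK.integral_rieszMeasure (stateFunctional hrt P₀ P₁)
    ⟨⟨g, hg⟩, HasCompactSupport.of_compactSpace _⟩)

theorem continuous_comp_expI (hf : ContinuousOn f (Metric.sphere 0 1)) :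
    Continuous fun x => f (expI x) :=
  hf.comp_continuous continuous_expI expI_mem_sphere

theorem integrable_comp_expI (hf : ContinuousOn f (Metric.sphere 0 1)) (k : Measure PhaseTorus)
    [IsFiniteMeasure k] : Integrable (fun x => f (expI x)) k := by
  obtain ⟨B, hB⟩ := exists_bound_on_sphere hf
  exact Integrable.of_bound (continuous_comp_expI hf).aestronglyMeasurable B
    (ae_of_all _ fun x => hB _ (expI_mem_sphere x))

theorem integral_stateMeasure (hf : ContinuousOn f (Metric.sphere 0 1)) :
    ∫ x, f (expI x) ∂(stateMeasure hrt P₀ P₁) = stateMean hrt P₀ P₁ f := by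
  have hc := continuous_comp_expI hf
  have hre : Continuous fun x => (f (expI x)).re := Complex.continuous_re.comp hc
  have him : Continuous fun x => (f (expI x)).im := Complex.continuous_im.comp hc
  rw [← integral_re_add_im (integrable_comp_expI hf _)]
  have h1 := integral_stateMeasure_real hrt P₀ P₁ hre
  have h2 := integral_stateMeasure_real hrt P₀ P₁ him
  have h3 : stateMean hrt P₀ P₁ f
      = stateMean hrt P₀ P₁ (circleFun fun x => (f (expI x)).re)
        + Complex.I * stateMean hrt P₀ P₁ (circleFun fun x => (f (expI x)).im) := by
    rw [← stateMean_const_mul hrt P₀ P₁ _ (continuousOn_circleFun him),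
      ← stateMean_add hrt P₀ P₁ (continuousOn_circleFun hre)
        (g := fun z => Complex.I * circleFun (fun x => (f (expI x)).im) z)
        (continuousOn_const.mul (continuousOn_circleFun him))]
    refine stateMean_congr hrt P₀ P₁ fun z hz => ?_
    obtain ⟨x, rfl⟩ := exists_expI_eq hz
    simp only [circleFun_expI]
    rw [mul_comm]
    exact (Complex.re_add_im _).symm
  rw [h3]
  refine congrArg₂ _ h1 ?_
  rw [mul_comm]
  exact congrArg₂ _ rfl h2

instance isProbabilityMeasure_stateMeasure : IsProbabilityMeasure (stateMeasure hrt P₀ P₁) := by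
  have h := integral_stateMeasure hrt P₀ P₁ (f := fun _ => 1) continuousOn_const
  rw [stateMean_one, integral_const, measureReal_def] at h
  refine ⟨(ENNReal.toReal_eq_one_iff _).1 ?_⟩
  exact_mod_cast (by simpa using h : (((stateMeasure hrt P₀ P₁ Set.univ).toReal : ℝ) : ℂ) = 1)

theorem half_integral_diagEntry_add (hf : ContinuousOn f (Metric.sphere 0 1)) :
    (∫ ω, (diagEntry hrt f 0 ω + diagEntry hrt f 1 ω) ∂(phaseLaw P₀ P₁)) / 2
      = stateMean hrt P₀ P₁ f := by
  rw [integral_add (integrable_diagEntry hrt P₀ P₁ hf 0) (integrable_diagEntry hrt P₀ P₁ hf 1)]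
  rfl

theorem isDensityOfStates_stateMeasure :
    IsDensityOfStates hrt P₀ P₁ (stateMeasure hrt P₀ P₁) := fun _ hf =>
  ⟨(integrable_diagEntry hrt P₀ P₁ hf 0).add (integrable_diagEntry hrt P₀ P₁ hf 1),
    (integral_stateMeasure hrt P₀ P₁ hf).trans (half_integral_diagEntry_add hrt P₀ P₁ hf).symm⟩

theorem eq_stateMeasure {k : Measure PhaseTorus} (hk : IsDensityOfStates hrt P₀ P₁ k) :
    k = stateMeasure hrt P₀ P₁ := by
  have hint : ∀ f : ℂ → ℂ, ContinuousOn f (Metric.sphere 0 1) →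
      ∫ x, f (expI x) ∂k = stateMean hrt P₀ P₁ f := fun f hf =>
    (hk f hf).2.trans (half_integral_diagEntry_add hrt P₀ P₁ hf)
  have h1 := hint (fun _ => 1) continuousOn_const
  -- Finiteness is not assumed of `k`: an infinite total mass would make the integral of `1` equal
  -- to the default value `0`, whereas it has to be `1`.
  have : IsFiniteMeasure k := by
    refine ⟨lt_top_iff_ne_top.2 fun htop => ?_⟩
    rw [stateMean_one, integral_const, measureReal_def, htop] at h1
    simp at h1
  refine ext_of_forall_integral_eq_of_IsFiniteMeasure fun g => ?_
  have h2 := hint _ (continuousOn_circleFun g.continuous)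
  rw [← integral_stateMeasure_real hrt P₀ P₁ g.continuous] at h2
  simp only [circleFun_expI] at h2
  rw [integral_complex_ofReal] at h2
  exact_mod_cast h2

/-! ### The almost sure spectrum -/

theorem eq_zero_of_apply_basisVec {A : LatticeSpace →L[ℂ] LatticeSpace}
    (h : ∀ j, A (basisVec j) = 0) : A = 0 := by
  let b : HilbertBasis ℤ ℂ LatticeSpace := ⟨LinearIsometryEquiv.refl ℂ LatticeSpace⟩
  have hb : ∀ j, b j = basisVec j := fun j => (HilbertBasis.repr_symm_single b j).symm
  refine ContinuousLinearMap.ext_on (s := Set.range b) ?_ ?_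
  · exact (Submodule.dense_iff_topologicalClosure_eq_top).2 b.dense_span
  · rintro _ ⟨j, rfl⟩
    rw [hb, h]
    rfl

theorem eqOn_zero_of_cfc_eq_zero (hf : ContinuousOn f (Metric.sphere 0 1))
    {ω : ℤ → PhaseTorus} (h : cfc f (randomU hrt ω) = 0) :
    Set.EqOn f 0 (spectrum ℂ (randomU hrt ω)) := by
  have := isStarNormal_randomU hrt ω
  refine eqOn_of_cfc_eq_cfc (a := randomU hrt ω) ?_ (hf.mono (spectrum_randomU_subset hrt ω))
    continuousOn_const
  rw [h]
  exact (cfc_zero ℂ _).symm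

/-- Faithfulness of the mean: two nonnegative integrals with sum zero both vanish, stationarity
carries this to all sites, and a countable intersection gives all basis vectors at once. -/
theorem ae_cfc_eq_zero (hf : ContinuousOn f (Metric.sphere 0 1))
    (h : stateMean hrt P₀ P₁ (fun z => star (f z) * f z) = 0) :
    ∀ᵐ ω ∂(phaseLaw P₀ P₁), cfc f (randomU hrt ω) = 0 := by
  have hff := continuousOn_star_mul_self hf
  rw [stateMean_star_mul_self hrt P₀ P₁ hf, Complex.ofReal_eq_zero] at h
  have hnn : ∀ j, 0 ≤ ∫ ω, ‖cfc f (randomU hrt ω) (basisVec j)‖ ^ 2 ∂(phaseLaw P₀ P₁) :=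
    fun j => integral_nonneg fun ω => by positivity
  have h0 := hnn 0
  have h1 := hnn 1
  have hj : ∀ j, ∫ ω, ‖cfc f (randomU hrt ω) (basisVec j)‖ ^ 2 ∂(phaseLaw P₀ P₁) = 0 := by
    intro j
    obtain ⟨m, hm⟩ := Int.even_or_odd' j
    have key : ∀ i, j = i + 2 * m →
        ∫ ω, ‖cfc f (randomU hrt ω) (basisVec i)‖ ^ 2 ∂(phaseLaw P₀ P₁) = 0 →
        ∫ ω, ‖cfc f (randomU hrt ω) (basisVec j)‖ ^ 2 ∂(phaseLaw P₀ P₁) = 0 := by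
      rintro i rfl hi
      have h2 := entryMean_add_two_mul hrt P₀ P₁ hff i m
      rw [entryMean_star_mul_self hrt P₀ P₁ hf, entryMean_star_mul_self hrt P₀ P₁ hf, hi] at h2
      exact_mod_cast h2
    rcases hm with hm | hm
    · exact key 0 (by omega) (by linarith)
    · exact key 1 (by omega) (by linarith)
  have hae : ∀ j, ∀ᵐ ω ∂(phaseLaw P₀ P₁), cfc f (randomU hrt ω) (basisVec j) = 0 := by
    intro j
    have hint : Integrable (fun ω => ‖cfc f (randomU hrt ω) (basisVec j)‖ ^ 2)
        (phaseLaw P₀ P₁) := by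
      refine (integrable_diagEntry hrt P₀ P₁ hff j).re.congr (ae_of_all _ fun ω => ?_)
      simp only [diagEntry_sq hrt hf]
      exact Complex.ofReal_re _
    filter_upwards [(integral_eq_zero_iff_of_nonneg (fun ω => by positivity) hint).1 (hj j)]
      with ω hω
    simpa using hω
  filter_upwards [ae_all_iff.2 hae] with ω hω
  exact eq_zero_of_apply_basisVec hω

theorem support_subset_of_stateMean_eq_zero (hf : ContinuousOn f (Metric.sphere 0 1))
    (h : stateMean hrt P₀ P₁ (fun z => star (f z) * f z) = 0) :
    (stateMeasure hrt P₀ P₁).support ⊆ {x | f (expI x) = 0} := by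
  have hc := continuous_comp_expI hf
  refine Measure.support_subset_of_isClosed (isClosed_eq hc continuous_const) ?_
  rw [← integral_stateMeasure hrt P₀ P₁ (continuousOn_star_mul_self hf)] at h
  have h1 : ∀ x, star (f (expI x)) * f (expI x) = ((‖f (expI x)‖ ^ 2 : ℝ) : ℂ) := fun x => by
    push_cast
    exact Complex.conj_mul' _
  simp only [h1] at h
  rw [integral_complex_ofReal, Complex.ofReal_eq_zero] at h
  have hint : Integrable (fun x => ‖f (expI x)‖ ^ 2) (stateMeasure hrt P₀ P₁) := by
    obtain ⟨B, hB⟩ := exists_bound_on_sphere hf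
    refine Integrable.of_bound (hc.norm.pow 2).aestronglyMeasurable (B ^ 2) (ae_of_all _ fun x => ?_)
    rw [norm_pow, norm_norm]
    exact pow_le_pow_left₀ (norm_nonneg _) (hB _ (expI_mem_sphere x)) 2
  filter_upwards [(integral_eq_zero_iff_of_nonneg (fun x => by positivity) hint).1 h] with x hx
  simpa using hx

/-- The distance to a set, as a complex function. -/
def distFun (S : Set ℂ) (z : ℂ) : ℂ := (Metric.infDist z S : ℝ)

theorem continuousOn_distFun (S : Set ℂ) : ContinuousOn (distFun S) (Metric.sphere 0 1) :=
  (Complex.continuous_ofReal.comp (Metric.continuous_infDist_pt S)).continuousOn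

theorem distFun_eq_zero_iff {S : Set ℂ} (hS : IsClosed S) (hne : S.Nonempty) {z : ℂ} :
    distFun S z = 0 ↔ z ∈ S := by
  rw [distFun, Complex.ofReal_eq_zero, hS.mem_iff_infDist_zero hne]

/-- The distance to the image of the support vanishes almost everywhere for the density of states,
so it annihilates almost every `U_ω`; the functional calculus is injective on functions continuous
on the spectrum. -/
theorem ae_spectrum_subset :
    ∀ᵐ ω ∂(phaseLaw P₀ P₁), spectrum ℂ (randomU hrt ω)
      ⊆ expI '' (stateMeasure hrt P₀ P₁).support := by
  set k := stateMeasure hrt P₀ P₁ with hk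
  set S := expI '' k.support with hSdef
  have hS : IsClosed S := (Measure.isClosed_support.isCompact.image continuous_expI).isClosed
  -- Needed because the distance to the empty set is `0` by convention, which would detect nothing.
  have hne : S.Nonempty :=
    (Measure.nonempty_support (IsProbabilityMeasure.ne_zero k)).image expI
  have hd := continuousOn_distFun S
  have h0 : stateMean hrt P₀ P₁ (fun z => star (distFun S z) * distFun S z) = 0 := by
    rw [← integral_stateMeasure hrt P₀ P₁ (continuousOn_star_mul_self hd)]
    refine integral_eq_zero_of_ae ?_
    filter_upwards [Measure.support_mem_ae (μ := k)] with x hx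
    simp only [(distFun_eq_zero_iff hS hne).2 (Set.mem_image_of_mem expI hx), mul_zero,
      Pi.zero_apply]
  filter_upwards [ae_cfc_eq_zero hrt P₀ P₁ hd h0] with ω hω z hz
  exact (distFun_eq_zero_iff hS hne).1 (eqOn_zero_of_cfc_eq_zero hrt hd hω hz)

instance nontrivial_latticeSpace : Nontrivial LatticeSpace :=
  ⟨basisVec 0, 0, fun h => by simpa [h] using norm_basisVec 0⟩

/-- For a typical fixed `ω`, the test function is the distance to its own spectrum. All its diagonal
entries vanish, so the law of large numbers forces its mean, and hence its values on the support, to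
vanish. -/
theorem ae_subset_spectrum :
    ∀ᵐ ω ∂(phaseLaw P₀ P₁), expI '' (stateMeasure hrt P₀ P₁).support
      ⊆ spectrum ℂ (randomU hrt ω) := by
  filter_upwards [ae_tendsto_boxAverage hrt P₀ P₁] with ω hω
  have := isStarNormal_randomU hrt ω
  set S := spectrum ℂ (randomU hrt ω) with hSdef
  have hS : IsClosed S := spectrum.isClosed _
  have hne : S.Nonempty := spectrum.nonempty _
  have hd := continuousOn_distFun S
  have hcfc : cfc (fun z => star (distFun S z) * distFun S z) (randomU hrt ω) = 0 := by
    rw [← cfc_zero ℂ (randomU hrt ω)]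
    refine cfc_congr fun z hz => ?_
    simp [(distFun_eq_zero_iff hS hne).2 hz]
  -- Any nonnegative constant would do in place of `1`; it only has to leave the filter nontrivial.
  have hlim := hω _ (continuousOn_star_mul_self hd) 1
  have h0 : ∀ j, diagEntry hrt (fun z => star (distFun S z) * distFun S z) j ω = 0 := fun j => by
    rw [diagEntry, hcfc]
    simp
  have := boxFilter_neBot (zero_le_one (α := ℝ))
  have hmean : stateMean hrt P₀ P₁ (fun z => star (distFun S z) * distFun S z) = 0 := by
    refine tendsto_nhds_unique hlim ?_
    simpa only [h0, Finset.sum_const_zero, zero_div] using tendsto_const_nhds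
  rintro _ ⟨x, hx, rfl⟩
  exact (distFun_eq_zero_iff hS hne).1
    (support_subset_of_stateMean_eq_zero hrt P₀ P₁ hd hmean hx)

end

end RandomUnitary

/-! ### Density of states and almost sure spectrum: conclusion -/

theorem mainTheorem7 (r t : ℝ) (hr : r ∈ Set.Ioo (0 : ℝ) 1) (ht : t ∈ Set.Ioo (0 : ℝ) 1)
    (hrt : r ^ 2 + t ^ 2 = 1) (P₀ P₁ : Measure PhaseTorus)
    [IsProbabilityMeasure P₀] [IsProbabilityMeasure P₁] :
    ∃ k : Measure PhaseTorus,
      -- `k` is the density of states, a probability measure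
      RandomUnitary.IsDensityOfStates hrt P₀ P₁ k ∧
      (∀ k' : Measure PhaseTorus, RandomUnitary.IsDensityOfStates hrt P₀ P₁ k' → k' = k) ∧
      IsProbabilityMeasure k ∧
      -- almost sure convergence of the normalized traces, for all continuous `f` at once
      (∀ᵐ ω ∂(RandomUnitary.phaseLaw P₀ P₁), ∀ f : ℂ → ℂ, ContinuousOn f (Metric.sphere 0 1) →
        ∀ C : ℝ, Tendsto
          (fun p : ℤ × ℤ =>
            RandomUnitary.latticeTrace (RandomUnitary.siteProj p.1 p.2 ∘L
              cfc f (RandomUnitary.randomU hrt ω) ∘L RandomUnitary.siteProj p.1 p.2)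
              / ((p.2 : ℂ) - (p.1 : ℂ)))
          (RandomUnitary.boxFilter C) (𝓝 (∫ x, f (RandomUnitary.expI x) ∂k))) ∧
      -- the support of `k` is the almost sure spectrum
      (∃ S : Set ℂ, RandomUnitary.IsAlmostSureSpectrum hrt P₀ P₁ S ∧
        RandomUnitary.expI '' k.support = S) := by
  refine ⟨RandomUnitary.stateMeasure hrt P₀ P₁,
    RandomUnitary.isDensityOfStates_stateMeasure hrt P₀ P₁,
    fun k' hk' => RandomUnitary.eq_stateMeasure hrt P₀ P₁ hk', inferInstance, ?_, _, ?_, rfl⟩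
  · filter_upwards [RandomUnitary.ae_tendsto_boxAverage hrt P₀ P₁] with ω hω f hf C
    simp only [RandomUnitary.latticeTrace_siteProj, RandomUnitary.integral_stateMeasure hrt P₀ P₁ hf]
    exact hω f hf C
  · filter_upwards [RandomUnitary.ae_spectrum_subset hrt P₀ P₁,
      RandomUnitary.ae_subset_spectrum hrt P₀ P₁] with ω h₁ h₂
    exact h₁.antisymm h₂
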